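/- Let $G_2:=\bigoplus_{n=1}^{\infty}\mathbb Z/2\mathbb Z$. For a countable abelian group $G$ and $A,S\subseteq G$ we use the following notions. * A Følner sequence is a sequence $(\Phi_n)$ of finite subsets of $G$ with $|(\Phi_n+g)\cap\Phi_n|/|\Phi_n|\to 1$ for every $g\in G$; the upper Banach density $d^*(A)$ is the supremum of $\limsup_{n\to\infty}|A\cap\Phi_n|/|\Phi_n|$ over all Følner sequences $(\Phi_n)$. * $A$ is syndetic if $A+F=G$ for some finite $F\subseteq G$. $A$ is piecewise syndetic if there is a syndetic set $B\subseteq G$ such that for every finite $F\subseteq B$ there is $g\in G$ with $F+g\subseteq A$. * $S$ is a set of topological recurrence if for every action $T$ of $G$ by homeomorphisms on a compact metric space $X$ all of whose orbits are dense, and every nonempty open $U\subseteq X$, there is $g\in S$ with $U\cap T^gU\neq\varnothing$. * The Bohr topology of $G$ is the weakest topology making every homomorphism $G\to\mathbb R/\mathbb Z$ continuous. $A$ is piecewise Bohr if there is a nonempty Bohr-open set $U\subseteq G$ such that for every finite $F\subseteq U$ there is $g\in G$ with $F+g\subseteq A$. * $bG$ is the Bohr compactification of $G$ (the closure of the image of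 $G$ in the product of copies of $\mathbb R/\mathbb Z$ indexed by all homomorphisms $\chi:G\to\mathbb R/\mathbb Z$, under $g\mapsto(\chi(g))_\chi$), $m_{bG}$ is its Haar probability measure, and $\tilde S$ is the closure of the image of $S$ in $bG$. **Theorem 1.4.** For every $\varepsilon>0$ there are sets $S,A\subseteq G_2$ such that $d^*(A)>1-\varepsilon$, every translate $S+g$ $(g\in G_2)$ is a set of topological recurrence, and $S+A$ is not piecewise syndetic. Moreover, for $G=G_2$, each of the following three implications fails for some $S,A\subseteq G_2$: 1. if $m_{bG}(\tilde S)>0$ and $d^*(A)>0$, then $S+A$ is piecewise syndetic; 2. if $m_{bG}(\tilde S)>0$ and $d^*(A)>0$, then $S+A$ is piecewise Bohr; 3. if $S$ is dense in the Bohr topology of $G$ and $d^*(A)>0$, then $d^*(S+A)=1$. -/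

import Mathlib

open scoped Pointwise DirectSum

/-- The countable direct sum `⨁ ℤ/2ℤ`. -/
abbrev G₂ : Type := ⨁ _ : ℕ, ZMod 2

section Combinatorics

variable {G : Type*} [AddCommGroup G]

/-- `A` is syndetic: `G` is a union of finitely many translates of `A`. -/
def IsSyndetic (A : Set G) : Prop :=
  ∃ F : Set G, F.Finite ∧ A + F = Set.univ

/-- `A` is piecewise syndetic: for some syndetic `B`, every finite subset of `B`
has a translate contained in `A`. -/
def IsPiecewiseSyndetic (A : Set G) : Prop :=
  ∃ B : Set G, IsSyndetic B ∧
    ∀ F : Set G, F.Finite → F ⊆ B → ∃ g : G, F + {g} ⊆ A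

/-- Følner sequences of `G`. (A set `Φ n` can be empty for finitely many `n` only, since
otherwise the quotient is `0` infinitely often.) -/
def IsFolnerSeq (Φ : ℕ → Finset G) : Prop :=
  ∀ g : G, Filter.Tendsto
    (fun n => (((((Φ n : Set G) + {g}) ∩ (Φ n : Set G)).ncard : ℝ) / ((Φ n).card : ℝ)))
    Filter.atTop (nhds 1)

/-- The upper density of `A` with respect to a sequence of finite sets. -/
noncomputable def upperDensity (Φ : ℕ → Finset G) (A : Set G) : ℝ :=
  Filter.limsup (fun n => ((A ∩ (Φ n : Set G)).ncard : ℝ) / ((Φ n).card : ℝ)) Filter.atTop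

/-- The upper Banach density `d*(A)`. The set on the right is a subset of `[0, 1]`. -/
noncomputable def upperBanachDensity (A : Set G) : ℝ :=
  sSup {d : ℝ | ∃ Φ : ℕ → Finset G, IsFolnerSeq Φ ∧ upperDensity Φ A = d}

end Combinatorics

section Dynamics

variable {G : Type*} [AddCommGroup G]

/-- `S` is a set of topological recurrence: for every minimal action of `G` by homeomorphisms
on a compact metric space and every nonempty open `U`, some `g ∈ S` has `U ∩ gU ≠ ∅`.
(Compact metric spaces have at most continuum many points, so `X : Type` covers all of them.) -/
def IsSetOfTopologicalRecurrence (S : Set G) : Prop :=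
  ∀ (X : Type) [MetricSpace X] [CompactSpace X] [AddAction G X] [ContinuousConstVAdd G X]
    [AddAction.IsMinimal G X] (U : Set X), IsOpen U → U.Nonempty →
    ∃ g ∈ S, (U ∩ (g +ᵥ U)).Nonempty

end Dynamics

section Bohr

/-- The Bohr topology on the discrete group `G`: the weakest topology making every homomorphism
`G → ℝ/ℤ` continuous. -/
@[reducible]
def bohrTopology (G : Type*) [AddCommGroup G] : TopologicalSpace G :=
  ⨅ χ : G →+ UnitAddCircle, TopologicalSpace.induced χ inferInstance

/-- `A` is piecewise Bohr: for some nonempty Bohr-open `U`, every finite subset of `U` has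
a translate contained in `A`. -/
def IsPiecewiseBohr {G : Type*} [AddCommGroup G] (A : Set G) : Prop :=
  ∃ U : Set G, @IsOpen G (bohrTopology G) U ∧ U.Nonempty ∧
    ∀ F : Set G, F.Finite → F ⊆ U → ∃ g : G, F + {g} ⊆ A

/-- `S` is dense in the Bohr topology of `G`. -/
def IsBohrDense {G : Type*} [AddCommGroup G] (S : Set G) : Prop :=
  @Dense G (bohrTopology G) S

/-- The homomorphism `g ↦ (χ(g))_χ` from `G` to the product of circles over all characters. -/
def bohrEval (G : Type*) [AddCommGroup G] :
    G →+ ((G →+ UnitAddCircle) → UnitAddCircle) where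
  toFun g χ := χ g
  map_zero' := by ext χ; simp
  map_add' a b := by ext χ; simp

/-- The Bohr compactification `bG` of the discrete group `G`: the closure of the image of `G`
in the product of circles over all characters of `G`. -/
def BohrCompactification (G : Type*) [AddCommGroup G] : Type _ :=
  (bohrEval G).range.topologicalClosure

variable (G : Type*) [AddCommGroup G]

namespace BohrCompactification

instance : AddCommGroup (BohrCompactification G) :=
  inferInstanceAs (AddCommGroup (bohrEval G).range.topologicalClosure)

instance : TopologicalSpace (BohrCompactification G) :=
  inferInstanceAs (TopologicalSpace (bohrEval G).range.topologicalClosure)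

instance : IsTopologicalAddGroup (BohrCompactification G) :=
  inferInstanceAs (IsTopologicalAddGroup (bohrEval G).range.topologicalClosure)

instance : T2Space (BohrCompactification G) :=
  inferInstanceAs (T2Space (bohrEval G).range.topologicalClosure)

instance : CompactSpace (BohrCompactification G) :=
  isCompact_iff_compactSpace.mp
    (bohrEval G).range.isClosed_topologicalClosure.isCompact

instance : MeasurableSpace (BohrCompactification G) := borel _

instance : BorelSpace (BohrCompactification G) := ⟨rfl⟩

/-- The canonical homomorphism `G → bG`. -/
def of : G →+ BohrCompactification G :=
  (AddSubgroup.inclusion (bohrEval G).range.le_topologicalClosure).comp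
    (bohrEval G).rangeRestrict

/-- Normalized Haar measure on `bG`. -/
noncomputable def haar : MeasureTheory.Measure (BohrCompactification G) :=
  MeasureTheory.Measure.addHaarMeasure ⊤

end BohrCompactification

end Bohr

/-! Split the coordinates of `G₂` into finite blocks, the `i`-th a cube with a set of steps whose
Cayley graph is not `i`-colourable (`exists_monochromatic_of_hammingNorm`, from Tucker's lemma). The
steps are the vectors of nearly full weight. Adding one nearly complements a point, so away from the
middle layers it flips the bit "weight above half". A bounded number of layers has small density in
a large cube, so one can discard the points where this fails, as well as those that are, or can be
sent to, a chosen point, the hole (`nonempty_cubePiece`).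

Choose `g i` supported on the blocks below `i`, so that every element of `G₂` occurs infinitely
often among them. The twist `θ` adds `g i` whenever the bit of block `i` is set. It is triangular,
hence a bijection, and a bit-flipping step `v` in block `i` satisfies `θ (y + v) = θ y + v + g i`
(`twist_add_blockEmb`).

Let `S` consist of all `v + g i`, with `v` a step of block `i`; let `A` be the `θ`-image of the
points good in every block, and `C` that of the points with a hole in some block. Since `u + u = 0`,
each translate `S + u` contains all steps of infinitely many blocks, so no finite colouring avoids
it. This gives topological recurrence and, by colouring with cosets of finite index, Bohr density.
The losses in the blocks are summable, so `A` has density close to `1`. A step from a good point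
never creates a hole, so `S + A` misses `C`; but `C` contains translates of every finite set with
bounded gaps. Hence `S + A` is not piecewise syndetic, and its upper Banach density is below `1`. -/

/-! ### Tucker's lemma by cochains modulo 2 -/

section Tucker

/-- The simplicial coboundary modulo 2 on cochains defined on lists of vertices. -/
def coboundary {α : Type*} : (List α → ZMod 2) → List α → ZMod 2
  | _, [] => 0
  | φ, x :: l => φ l + coboundary (fun m => φ (x :: m)) l

lemma coboundary_add {α : Type*} (l : List α) (φ ψ : List α → ZMod 2) :
    coboundary (fun m => φ m + ψ m) l = coboundary φ l + coboundary ψ l := by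
  induction l generalizing φ ψ with
  | nil => simp [coboundary]
  | cons x l ih => simp only [coboundary, ih]; ring

lemma coboundary_map {α β : Type*} (f : α → β) (l : List α) (φ : List β → ZMod 2) :
    coboundary (fun m => φ (m.map f)) l = coboundary φ (l.map f) := by
  induction l generalizing φ with
  | nil => simp [coboundary]
  | cons x l ih =>
    simp only [coboundary, List.map_cons]
    rw [ih (fun m => φ (f x :: m))]

lemma coboundary_congr {α : Type*} (l : List α) (φ ψ : List α → ZMod 2)
    (h : ∀ m, m.Sublist l → φ m = ψ m) : coboundary φ l = coboundary ψ l := by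
  induction l generalizing φ ψ with
  | nil => simp [coboundary]
  | cons x l ih =>
    simp only [coboundary]
    rw [h l (List.sublist_cons_self _ _), ih _ (fun m => ψ (x :: m)) fun m hm => h _ (hm.cons_cons x)]

lemma coboundary_perm {α : Type*} {l l' : List α} (hl : l.Perm l') (φ : List α → ZMod 2)
    (h : ∀ m m' : List α, m.Perm m' → φ m = φ m') : coboundary φ l = coboundary φ l' := by
  induction hl generalizing φ with
  | nil => rfl
  | cons x hl ih =>
    simp only [coboundary]
    rw [h _ _ hl, ih _ fun m m' hm => h _ _ (hm.cons x)]
  | swap x y l =>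
    simp only [coboundary]
    rw [show (fun m => φ (x :: y :: m)) = fun m => φ (y :: x :: m) from
      funext fun m => h _ _ (List.Perm.swap _ _ _)]
    ring
  | trans _ _ ih₁ ih₂ => rw [ih₁ φ h, ih₂ φ h]

/-- The dual of the prism between the identity and `f`. -/
def prismAux {α : Type*} (f : α → α) : (List α → ZMod 2) → List α → ZMod 2
  | _, [] => 0
  | φ, x :: l => φ (x :: f x :: l.map f) + prismAux f (fun m => φ (x :: m)) l

/-- The dual of the homotopy contracting the identity, through `f`, to the vertex `e`. -/
def prism {α : Type*} (e : α) (f : α → α) (φ : List α → ZMod 2) (l : List α) : ZMod 2 :=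
  φ (e :: l.map f) + prismAux f φ l

lemma prismAux_add {α : Type*} (f : α → α) (l : List α) (φ ψ : List α → ZMod 2) :
    prismAux f (fun m => φ m + ψ m) l = prismAux f φ l + prismAux f ψ l := by
  induction l generalizing φ ψ with
  | nil => simp [prismAux]
  | cons x l ih => simp only [prismAux, ih]; ring

/-- The prism over a simplex has as boundary its two ends and the prism over its boundary; modulo 2
no signs are needed. -/
lemma prismAux_coboundary {α : Type*} (f : α → α) (l : List α) (φ : List α → ZMod 2) :
    prismAux f (coboundary φ) l + coboundary (prismAux f φ) l = φ l + φ (l.map f) := by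
  induction l generalizing φ with
  | nil => simp [prismAux, coboundary, CharTwo.add_self_eq_zero]
  | cons x l ih =>
    have h3 := coboundary_map f l (fun m => φ (x :: f x :: m))
    have := ih (fun m => φ (x :: m))
    simp only [prismAux, coboundary, List.map_cons]
    rw [prismAux_add, coboundary_add, h3]
    have e2 : ∀ a : ZMod 2, a + a = 0 := CharTwo.add_self_eq_zero
    linear_combination this + e2 (prismAux f φ l) + e2 (φ (x :: l.map f)) +
      e2 (coboundary (fun m => φ (x :: f x :: m)) (l.map f))

lemma prism_coboundary {α : Type*} (e : α) (f : α → α) (l : List α) (φ : List α → ZMod 2) :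
    prism e f (coboundary φ) l + coboundary (prism e f φ) l = φ l := by
  have h := prismAux_coboundary f l φ
  have h2 : coboundary (prism e f φ) l =
      coboundary (fun m => φ (e :: m)) (l.map f) + coboundary (prismAux f φ) l := by
    rw [← coboundary_map f l (fun m => φ (e :: m)), ← coboundary_add]; rfl
  rw [h2, prism]
  simp only [coboundary]
  have e2 : ∀ a : ZMod 2, a + a = 0 := CharTwo.add_self_eq_zero
  linear_combination h + e2 (φ (l.map f)) + e2 (coboundary (fun m => φ (e :: m)) (l.map f))

/-- `alternating b l` is `1` if the parities in `l` alternate and start with `b`. -/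
def alternating : Bool → List ℕ → ZMod 2
  | _, [] => 1
  | b, m :: l => if m.bodd = b then alternating (!b) l else 0

lemma coboundary_zero {α : Type*} (l : List α) : coboundary (fun _ => 0) l = 0 := by
  induction l with
  | nil => rfl
  | cons x l ih => simp [coboundary, ih]

/-- An alternating list has one alternating face with a prescribed first parity, got by deleting an
end. A list with a single adjacent repetition has two equal such faces, which cancel. Any other list
has none. -/
lemma coboundary_alternating (b : Bool) (l : List ℕ) (hl : l ≠ []) :
    coboundary (alternating b) l = alternating b l + alternating (!b) l := by
  induction l generalizing b with
  | nil => exact absurd rfl hl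
  | cons x l ih =>
    by_cases hx : x.bodd = b
    · have : (fun m => alternating b (x :: m)) = alternating (!b) := by
        funext m; simp [alternating, hx]
      simp only [coboundary, this]
      rcases eq_or_ne l [] with rfl | hl'
      · cases b <;> simp [coboundary, alternating, hx]
      · rw [ih _ hl', Bool.not_not]
        simp only [alternating, hx, if_true]
        have e2 : ∀ a : ZMod 2, a + a = 0 := CharTwo.add_self_eq_zero
        have : b ≠ !b := by cases b <;> simp
        rw [if_neg this]
        linear_combination e2 (alternating b l)
    · have : (fun m => alternating b (x :: m)) = fun _ => 0 := by
        funext m; simp [alternating, hx]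
      have hx' : x.bodd = !b := by revert hx; cases x.bodd <;> cases b <;> simp
      simp only [coboundary, alternating, hx', Bool.not_not]
      cases b <;> simp [coboundary_zero]

/-- The cochain counting the simplices whose labels, in increasing order, alternate in parity. -/
def alternatingSort (b : Bool) (l : List ℕ) : ZMod 2 := alternating b ((l : Multiset ℕ).sort (· ≤ ·))

lemma alternatingSort_perm (b : Bool) {l l' : List ℕ} (h : l.Perm l') :
    alternatingSort b l = alternatingSort b l' := by
  unfold alternatingSort
  rw [Multiset.coe_eq_coe.2 h]

lemma alternatingSort_of_sorted (b : Bool) {l : List ℕ} (h : l.Pairwise (· ≤ ·)) :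
    alternatingSort b l = alternating b l := by
  unfold alternatingSort
  congr 1
  exact (Multiset.coe_eq_coe.1 (Multiset.sort_eq (l : Multiset ℕ) (· ≤ ·))).eq_of_pairwise'
    (Multiset.pairwise_sort _ _) h

lemma coboundary_alternatingSort (b : Bool) (l : List ℕ) (hl : l ≠ []) :
    coboundary (alternatingSort b) l = alternatingSort b l + alternatingSort (!b) l := by
  have hp : l.Perm ((l : Multiset ℕ).sort (· ≤ ·)) :=
    (Multiset.coe_eq_coe.1 (Multiset.sort_eq (l : Multiset ℕ) (· ≤ ·))).symm
  rw [coboundary_perm hp _ fun m m' h => alternatingSort_perm b h,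
    coboundary_congr _ _ (alternating b) fun m hm => alternatingSort_of_sorted b
      ((Multiset.pairwise_sort _ _).sublist hm), coboundary_alternating]
  · rfl
  · intro h
    rw [h] at hp
    exact hl hp.eq_nil

/-- Exchange `2 * a` and `2 * a + 1`. -/
def flipParity (m : ℕ) : ℕ := Nat.bit (!m.bodd) m.div2

lemma bodd_flipParity (m : ℕ) : (flipParity m).bodd = !m.bodd := by simp [flipParity]

lemma div2_flipParity (m : ℕ) : (flipParity m).div2 = m.div2 := by simp [flipParity]

lemma alternating_map_flipParity (b : Bool) (l : List ℕ) :
    alternating b (l.map flipParity) = alternating (!b) l := by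
  induction l generalizing b with
  | nil => rfl
  | cons x l ih =>
    simp only [List.map_cons, alternating, ih, bodd_flipParity]
    cases b <;> cases x.bodd <;> simp

/-- Without complementary labels, two labels are equal or differ in absolute value, so changing all
signs preserves their order. -/
lemma alternatingSort_map_flipParity (b : Bool) (l : List ℕ)
    (h : ∀ x ∈ l, ∀ y ∈ l, x.div2 = y.div2 → x = y) :
    alternatingSort b (l.map flipParity) = alternatingSort (!b) l := by
  have hp : l.Perm ((l : Multiset ℕ).sort (· ≤ ·)) :=
    (Multiset.coe_eq_coe.1 (Multiset.sort_eq (l : Multiset ℕ) (· ≤ ·))).symm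
  rw [alternatingSort_perm b (hp.map flipParity), alternatingSort_of_sorted,
    alternating_map_flipParity]
  · rfl
  rw [List.pairwise_map]
  refine (Multiset.pairwise_sort (l : Multiset ℕ) (· ≤ ·)).imp_of_mem ?_
  intro x y hx hy hxy
  have hxl : x ∈ l := hp.mem_iff.2 hx
  have hyl : y ∈ l := hp.mem_iff.2 hy
  by_cases hd : x.div2 = y.div2
  · rw [h x hxl y hyl hd]
  · have h1 := div2_flipParity x
    have h2 := div2_flipParity y
    simp only [Nat.div2_val] at *
    omega

/-- Consecutive entries have opposite signs, so their absolute values cannot agree and must strictly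
increase. The lower bound `c` carries the induction. -/
lemma length_le_of_alternating (M : ℕ) (b : Bool) (c : ℕ) (l : List ℕ) (hs : l.Pairwise (· ≤ ·))
    (h : ∀ x ∈ l, ∀ y ∈ l, x.div2 = y.div2 → x = y) (hM : ∀ x ∈ l, x.div2 < M)
    (hc : ∀ x ∈ l, c ≤ x.div2) (hcM : c ≤ M) (ha : alternating b l ≠ 0) : l.length + c ≤ M := by
  induction l generalizing b c with
  | nil => simpa using hcM
  | cons x l ih =>
    have hx : x.bodd = b := by
      by_contra hx; simp [alternating, hx] at ha
    have ha' : alternating (!b) l ≠ 0 := by simpa [alternating, hx] using ha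
    have hxM := hM x (by simp)
    have hxc := hc x (by simp)
    have := ih (!b) (x.div2 + 1) hs.of_cons
      (fun u hu v hv => h u (List.mem_cons_of_mem _ hu) v (List.mem_cons_of_mem _ hv))
      (fun u hu => hM u (List.mem_cons_of_mem _ hu)) ?_ hxM ha'
    · simp only [List.length_cons]; omega
    · intro u hu
      cases l with
      | nil => simp at hu
      | cons y l =>
        have hy : y.bodd = !b := by
          by_contra hy; simp [alternating, hy] at ha'
        have hxy : x ≤ y := (List.pairwise_cons.1 hs).1 y (by simp)
        have hne : x.div2 ≠ y.div2 := by
          intro hd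
          have := h x (by simp) y (by simp) hd
          subst this
          rw [hx] at hy
          cases b <;> simp at hy
        have hyu : y ≤ u := by
          rcases List.mem_cons.1 hu with rfl | hu
          · exact le_rfl
          · exact (List.pairwise_cons.1 hs.of_cons).1 u hu
        simp only [Nat.div2_val] at *
        omega

lemma alternatingSort_eq_zero (M : ℕ) (b : Bool) (l : List ℕ)
    (h : ∀ x ∈ l, ∀ y ∈ l, x.div2 = y.div2 → x = y) (hM : ∀ x ∈ l, x.div2 < M)
    (hl : M < l.length) : alternatingSort b l = 0 := by
  have hp : l.Perm ((l : Multiset ℕ).sort (· ≤ ·)) :=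
    (Multiset.coe_eq_coe.1 (Multiset.sort_eq (l : Multiset ℕ) (· ≤ ·))).symm
  by_contra ha
  have := length_le_of_alternating M b 0 _ (Multiset.pairwise_sort (l : Multiset ℕ) (· ≤ ·))
    (fun x hx y hy => h x (hp.mem_iff.2 hx) y (hp.mem_iff.2 hy))
    (fun x hx => hM x (hp.mem_iff.2 hx)) (by simp) (by simp) ha
  rw [← hp.length_eq] at this
  omega

/-- Sets of signed coordinates. -/
abbrev SignedSet : Type := Finset (ℕ × Bool)

/-- The antipode of a signed set. -/
def antipode (X : SignedSet) : SignedSet := X.image fun p => (p.1, !p.2)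

lemma mem_antipode {X : SignedSet} {p : ℕ × Bool} : p ∈ antipode X ↔ (p.1, !p.2) ∈ X := by
  simp only [antipode, Finset.mem_image]
  constructor
  · rintro ⟨q, hq, rfl⟩; simpa using hq
  · intro h; exact ⟨_, h, by simp⟩

/-- A nonempty signed set on the first `n` coordinates, with no coordinate of both signs. -/
structure IsSignVector (n : ℕ) (X : SignedSet) : Prop where
  nonempty : X.Nonempty
  lt : ∀ p ∈ X, p.1 < n
  consistent : ∀ p ∈ X, (p.1, !p.2) ∉ X

lemma IsSignVector.antipode {n : ℕ} {X : SignedSet} (h : IsSignVector n X) :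
    IsSignVector n (antipode X) where
  nonempty := h.nonempty.image _
  lt p hp := h.lt (p.1, !p.2) (mem_antipode.1 hp)
  consistent p hp hp' := h.consistent (p.1, !p.2) (mem_antipode.1 hp) (mem_antipode.1 hp')

lemma IsSignVector.insert {n : ℕ} {X : SignedSet} (h : IsSignVector n X) :
    IsSignVector (n + 1) (insert (n, true) X) where
  nonempty := Finset.insert_nonempty _ _
  lt p hp := by
    rcases Finset.mem_insert.1 hp with rfl | hp
    · simp
    · exact (h.lt p hp).trans (Nat.lt_succ_self n)
  consistent p hp hp' := by
    rcases Finset.mem_insert.1 hp with rfl | hp <;> rcases Finset.mem_insert.1 hp' with hp' | hp'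
    · simp at hp'
    · exact (h.lt _ hp').false
    · rw [Prod.ext_iff] at hp'
      exact (h.lt p hp).ne hp'.1
    · exact h.consistent p hp hp'

lemma IsSignVector.mono {n : ℕ} {X : SignedSet} (h : IsSignVector n X) :
    IsSignVector (n + 1) X :=
  ⟨h.nonempty, fun p hp => (h.lt p hp).trans (Nat.lt_succ_self n), h.consistent⟩

lemma isSignVector_singleton (n : ℕ) (b : Bool) : IsSignVector (n + 1) {(n, b)} where
  nonempty := by simp
  lt p hp := by simp only [Finset.mem_singleton] at hp; subst hp; simp
  consistent p hp hp' := by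
    simp only [Finset.mem_singleton] at hp hp'; subst hp; simp at hp'

/-- Ordered simplices of the barycentric subdivision of the cross-polytope. -/
structure IsFlag (n : ℕ) (l : List SignedSet) : Prop where
  isSignVector : ∀ X ∈ l, IsSignVector n X
  pairwise : l.Pairwise (· ⊆ ·)

lemma IsFlag.map_antipode {n : ℕ} {l : List SignedSet} (h : IsFlag n l) :
    IsFlag n (l.map antipode) where
  isSignVector X hX := by
    obtain ⟨Y, hY, rfl⟩ := List.mem_map.1 hX
    exact (h.isSignVector Y hY).antipode
  pairwise := by
    rw [List.pairwise_map]
    exact h.pairwise.imp fun hXY => Finset.image_subset_image hXY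

/-- Since `x ⊆ insert (n, true) x`, the prism over a flag consists of flags with one more
coordinate. The suffices-statement carries along the vertices already passed, as the prefix `p`. -/
lemma prismAux_eq_zero (n : ℕ) (φ : List SignedSet → ZMod 2) (k : ℕ)
    (hφ : ∀ l, l.length = k + 1 → IsFlag (n + 1) l → φ l = 0) (l : List SignedSet)
    (hl : l.length = k) (h : IsFlag n l) : prismAux (insert (n, true)) φ l = 0 := by
  suffices H : ∀ l p : List SignedSet, (p ++ l).length = k → IsFlag n (p ++ l) →
      prismAux (insert (n, true)) (fun m => φ (p ++ m)) l = 0 from H l [] hl h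
  intro l
  induction l with
  | nil => intros; rfl
  | cons x l ih =>
    intro p hk hp
    have h1 := ih (p ++ [x]) (by simpa using hk) (by simpa using hp)
    simp only [List.append_assoc, List.singleton_append] at h1
    simp only [prismAux, h1, add_zero]
    refine hφ _ (by simp at hk ⊢; omega) ⟨?_, ?_⟩
    · intro X hX
      simp only [List.mem_append, List.mem_cons, List.mem_map] at hX
      rcases hX with hX | rfl | rfl | ⟨Y, hY, rfl⟩
      · exact (hp.isSignVector X (by simp [hX])).mono
      · exact (hp.isSignVector X (by simp)).mono
      · exact (hp.isSignVector x (by simp)).insert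
      · exact (hp.isSignVector Y (by simp [hY])).insert
    · have h2 := hp.pairwise
      rw [List.pairwise_append, List.pairwise_cons] at h2 ⊢
      obtain ⟨hpp, ⟨hxl, hll⟩, hpl⟩ := h2
      refine ⟨hpp, ⟨?_, List.pairwise_cons.2 ⟨?_, ?_⟩⟩, ?_⟩
      · intro Y hY
        simp only [List.mem_cons, List.mem_map] at hY
        rcases hY with rfl | ⟨Z, hZ, rfl⟩
        · exact Finset.subset_insert _ _
        · exact (hxl Z hZ).trans (Finset.subset_insert _ _)
      · intro Y hY
        obtain ⟨Z, hZ, rfl⟩ := List.mem_map.1 hY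
        exact Finset.insert_subset_insert _ (hxl Z hZ)
      · rw [List.pairwise_map]
        exact hll.imp fun h => Finset.insert_subset_insert _ h
      · intro a ha b hb
        simp only [List.mem_cons, List.mem_map] at hb
        rcases hb with rfl | rfl | ⟨Z, hZ, rfl⟩
        · exact hpl a ha b (by simp)
        · exact (hpl a ha x (by simp)).trans (Finset.subset_insert _ _)
        · exact (hpl a ha Z (by simp [hZ])).trans (Finset.subset_insert _ _)

lemma prism_eq_zero (n : ℕ) (φ : List SignedSet → ZMod 2) (k : ℕ)
    (hφ : ∀ l, l.length = k + 1 → IsFlag (n + 1) l → φ l = 0) (l : List SignedSet)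
    (hl : l.length = k) (h : IsFlag n l) : prism {(n, true)} (insert (n, true)) φ l = 0 := by
  rw [prism, prismAux_eq_zero n φ k hφ l hl h, add_zero]
  refine hφ _ (by simp [hl]) ⟨?_, ?_⟩
  · intro X hX
    simp only [List.mem_cons, List.mem_map] at hX
    rcases hX with rfl | ⟨Y, hY, rfl⟩
    · exact isSignVector_singleton _ _
    · exact (h.isSignVector Y hY).insert
  · refine List.pairwise_cons.2 ⟨?_, ?_⟩
    · intro Y hY
      obtain ⟨Z, hZ, rfl⟩ := List.mem_map.1 hY
      simp
    · rw [List.pairwise_map]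
      exact h.pairwise.imp fun h => Finset.insert_subset_insert _ h

lemma prism_add {α : Type*} (e : α) (f : α → α) (φ ψ : List α → ZMod 2) :
    prism e f (fun m => φ m + ψ m) = fun l => prism e f φ l + prism e f ψ l := by
  funext l
  simp only [prism, prismAux_add]
  ring

/-- Evaluation of cochains on the chain of all simplices in the hemisphere of dimension `n`. -/
def hemisphere : ℕ → (List SignedSet → ZMod 2) → ZMod 2
  | 0, φ => φ [{(0, true)}]
  | n + 1, φ =>
    hemisphere n (prism {(n + 1, true)} (insert (n + 1, true)) φ) +
      hemisphere n fun l => prism {(n + 1, true)} (insert (n + 1, true)) φ (l.map antipode)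

lemma hemisphere_add (n : ℕ) (φ ψ : List SignedSet → ZMod 2) :
    hemisphere n (fun l => φ l + ψ l) = hemisphere n φ + hemisphere n ψ := by
  induction n generalizing φ ψ with
  | zero => rfl
  | succ n ih =>
    simp only [hemisphere, prism_add, ih]
    ring

lemma hemisphere_eq_zero (n : ℕ) (φ : List SignedSet → ZMod 2)
    (h : ∀ l, l.length = n + 1 → IsFlag (n + 1) l → φ l = 0) : hemisphere n φ = 0 := by
  induction n generalizing φ with
  | zero =>
    refine h _ rfl ⟨?_, by simp⟩
    intro X hX
    rw [List.mem_singleton] at hX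
    subst hX
    exact isSignVector_singleton 0 true
  | succ n ih =>
    have key := prism_eq_zero (n + 1) φ (n + 1) h
    rw [hemisphere, ih _ key, ih _ fun l hl hf => key _ (by simpa using hl) hf.map_antipode,
      add_zero]

lemma hemisphere_congr (n : ℕ) (φ ψ : List SignedSet → ZMod 2)
    (h : ∀ l, l.length = n + 1 → IsFlag (n + 1) l → φ l = ψ l) :
    hemisphere n φ = hemisphere n ψ := by
  have e2 : ∀ a : ZMod 2, a + a = 0 := CharTwo.add_self_eq_zero
  have := hemisphere_eq_zero n (fun l => φ l + ψ l) fun l hl hf => by rw [h l hl hf, e2]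
  rw [hemisphere_add] at this
  linear_combination this - e2 (hemisphere n ψ)

lemma map_antipode_antipode (l : List SignedSet) : (l.map antipode).map antipode = l := by
  rw [List.map_map]
  convert List.map_id l
  funext X
  ext p
  simp [mem_antipode]

/-- The boundary of a hemisphere is the sphere one dimension lower, a hemisphere plus its antipode.
That sphere is a cycle, so the contracting homotopy fills it by the next hemisphere; the two facts
feed each other in the induction. -/
lemma hemisphere_coboundary (n : ℕ) : (∀ ψ : List SignedSet → ZMod 2,
      hemisphere n (coboundary ψ) + hemisphere n (fun l => coboundary ψ (l.map antipode)) = 0) ∧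
    ∀ ψ : List SignedSet → ZMod 2, hemisphere (n + 1) (coboundary ψ) =
      hemisphere n ψ + hemisphere n fun l => ψ (l.map antipode) := by
  have e2 : ∀ a : ZMod 2, a + a = 0 := CharTwo.add_self_eq_zero
  have step : ∀ n, (∀ ψ : List SignedSet → ZMod 2,
      hemisphere n (coboundary ψ) + hemisphere n (fun l => coboundary ψ (l.map antipode)) = 0) →
      ∀ ψ : List SignedSet → ZMod 2, hemisphere (n + 1) (coboundary ψ) =
      hemisphere n ψ + hemisphere n fun l => ψ (l.map antipode) := by
    intro n h ψ
    have h1 := h (prism {(n + 1, true)} (insert (n + 1, true)) ψ)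
    have h2 : hemisphere n ψ = _ := congrArg (hemisphere n) (funext fun l =>
      (prism_coboundary {(n + 1, true)} (insert (n + 1, true)) l ψ).symm)
    have h3 : hemisphere n (fun l => ψ (l.map antipode)) = _ :=
      congrArg (hemisphere n) (funext fun l =>
        (prism_coboundary {(n + 1, true)} (insert (n + 1, true)) (l.map antipode) ψ).symm)
    rw [hemisphere_add] at h2 h3
    rw [h2, h3, hemisphere]
    linear_combination -h1
  induction n with
  | zero =>
    have : ∀ ψ : List SignedSet → ZMod 2,
      hemisphere 0 (coboundary ψ) + hemisphere 0 (fun l => coboundary ψ (l.map antipode)) = 0 := by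
      intro ψ
      simp [hemisphere, coboundary, e2]
    exact ⟨this, step 0 this⟩
  | succ n ih =>
    have : ∀ ψ : List SignedSet → ZMod 2, hemisphere (n + 1) (coboundary ψ) +
        hemisphere (n + 1) (fun l => coboundary ψ (l.map antipode)) = 0 := by
      intro ψ
      have h1 : (fun l => coboundary ψ (l.map antipode)) =
          coboundary fun l => ψ (l.map antipode) :=
        funext fun l => (coboundary_map antipode l ψ).symm
      rw [h1, ih.2, ih.2]
      simp only [map_antipode_antipode]
      linear_combination e2 (hemisphere n ψ) + e2 (hemisphere n fun l => ψ (l.map antipode))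
    exact ⟨this, step _ this⟩

/-- **Tucker's lemma** for the barycentric subdivision of the cross-polytope; the label `m` has
absolute value `m / 2` and its parity is its sign. -/
theorem tucker (n M : ℕ) (label : SignedSet → ℕ)
    (hanti : ∀ X, IsSignVector n X → label (antipode X) = flipParity (label X))
    (hcompl : ∀ X Y, IsSignVector n X → IsSignVector n Y → X ⊆ Y →
      (label X).div2 = (label Y).div2 → label X = label Y)
    (hM : ∀ X, IsSignVector n X → (label X).div2 < M) : n ≤ M := by
  have mono : ∀ {m n X}, m ≤ n → IsSignVector m X → IsSignVector n X := fun h hX =>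
    ⟨hX.nonempty, fun p hp => (hX.lt p hp).trans_le h, hX.consistent⟩
  have compl : ∀ {j l}, j ≤ n → IsFlag j l → ∀ x ∈ l.map label, ∀ y ∈ l.map label,
      x.div2 = y.div2 → x = y := by
    intro j l hj hl x hx y hy hxy
    obtain ⟨X, hX, rfl⟩ := List.mem_map.1 hx
    obtain ⟨Y, hY, rfl⟩ := List.mem_map.1 hy
    have hX' := mono hj (hl.isSignVector X hX)
    have hY' := mono hj (hl.isSignVector Y hY)
    have : X ⊆ Y ∨ Y ⊆ X := by
      obtain ⟨a, ha, rfl⟩ := List.getElem_of_mem hX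
      obtain ⟨b, hb, rfl⟩ := List.getElem_of_mem hY
      have hp := List.pairwise_iff_getElem.1 hl.pairwise
      rcases lt_trichotomy a b with h | rfl | h
      · exact Or.inl (hp a b ha hb h)
      · exact Or.inl (subset_refl _)
      · exact Or.inr (hp b a hb ha h)
    rcases this with h | h
    · exact hcompl X Y hX' hY' h hxy
    · exact (hcompl Y X hY' hX' h hxy.symm).symm
  have anti : ∀ {j l}, j ≤ n → IsFlag j l → ∀ b,
      alternatingSort b ((l.map antipode).map label) = alternatingSort (!b) (l.map label) := by
    intro j l hj hl b
    rw [← alternatingSort_map_flipParity b _ (compl hj hl), List.map_map, List.map_map]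
    congr 1
    exact List.map_congr_left fun X hX => hanti X (mono hj (hl.isSignVector X hX))
  -- The number of alternating simplices in the `j`-hemisphere, of either starting sign, is odd: by
  -- antipodality it is the coboundary of the count with one starting sign, hence that count on the
  -- sphere one dimension lower. In top dimension such a simplex has `n` distinct absolute values.
  have key : ∀ j, j + 1 ≤ n → hemisphere j (fun l => alternatingSort true (l.map label)) +
      hemisphere j (fun l => alternatingSort true ((l.map antipode).map label)) = 1 := by
    intro j
    induction j with
    | zero =>
      intro hj
      have h0 := anti (l := [{(0, true)}]) hj ⟨by simpa using isSignVector_singleton 0 true, by simp⟩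
        true
      simp only [hemisphere]
      rw [h0]
      simp only [List.map_cons, List.map_nil]
      rw [alternatingSort_of_sorted _ (by simp), alternatingSort_of_sorted _ (by simp)]
      simp only [alternating]
      cases (label {(0, true)}).bodd <;> simp
    | succ j ih =>
      intro hj
      rw [← ih (by omega), ← (hemisphere_coboundary j).2
        (fun l => alternatingSort true (l.map label)), ← hemisphere_add]
      refine hemisphere_congr _ _ _ fun l hl hf => ?_
      rw [coboundary_map, coboundary_alternatingSort _ _ (by
        intro h; rw [List.map_eq_nil_iff] at h; simp [h] at hl), anti hj hf]
  by_contra! hlt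
  obtain ⟨j, rfl⟩ : ∃ j, n = j + 1 := ⟨n - 1, by omega⟩
  have h1 := key j le_rfl
  have hz : ∀ l, l.length = j + 1 → IsFlag (j + 1) l → alternatingSort true (l.map label) = 0 := by
    intro l hl hf
    refine alternatingSort_eq_zero M _ _ (compl le_rfl hf) ?_ (by simpa [hl] using hlt)
    intro x hx
    obtain ⟨X, hX, rfl⟩ := List.mem_map.1 hx
    exact hM X (hf.isSignVector X hX)
  rw [hemisphere_eq_zero j _ hz,
    hemisphere_eq_zero j _ fun l hl hf => hz _ (by simpa using hl) hf.map_antipode] at h1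
  simp at h1

end Tucker

/-! ### Cayley graphs of large chromatic number on cubes -/

section HammingCube

lemma antipode_antipode (X : SignedSet) : antipode (antipode X) = X := by
  ext p; simp [mem_antipode]

lemma card_antipode (X : SignedSet) : (antipode X).card = X.card :=
  Finset.card_image_of_injective _ fun p q h => by
    simpa [Prod.ext_iff] using h

lemma antipode_subset {X Y : SignedSet} (h : X ⊆ Y) : antipode X ⊆ antipode Y :=
  Finset.image_subset_image h

/-- The indicator vector of the coordinates at which `X` is positive. -/
def positiveVector (n : ℕ) (X : SignedSet) : Fin n → ZMod 2 :=
  fun i => if ((i : ℕ), true) ∈ X then 1 else 0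

/-- At each coordinate of `X`, exactly one of the positive part of `X` and the negative part of `Y`
is nonzero. -/
lemma card_le_hammingNorm_positiveVector {n : ℕ} {X Y : SignedSet} (hX : IsSignVector n X)
    (hY : IsSignVector n Y) (h : X ⊆ Y) :
    X.card ≤ hammingNorm (positiveVector n X + positiveVector n (antipode Y)) := by
  unfold hammingNorm
  have hlt : ∀ p : X, p.1.1 < n := fun p => hX.lt p.1 p.2
  rw [← Fintype.card_coe X, ← Fintype.card_coe]
  refine Fintype.card_le_of_injective (fun p : X => ⟨⟨p.1.1, hlt p⟩, ?_⟩) ?_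
  · rw [Finset.mem_filter]
    refine ⟨Finset.mem_univ _, ?_⟩
    obtain ⟨⟨i, b⟩, hp⟩ := p
    have h1 := h hp
    have h2 := hY.consistent _ h1
    have h3 := hX.consistent _ hp
    cases b
    · simp only [Bool.not_false] at h3
      simp [positiveVector, mem_antipode, h1, h3]
    · simp only [Bool.not_true] at h2
      simp [positiveVector, mem_antipode, hp, h2]
  · intro p q hpq
    simp only [Subtype.mk.injEq, Fin.mk.injEq] at hpq
    obtain ⟨⟨i, b⟩, hp⟩ := p
    obtain ⟨⟨j, b'⟩, hq⟩ := q
    simp only at hpq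
    subst hpq
    have h3 := hX.consistent _ hp
    simp only [Subtype.mk.injEq, Prod.mk.injEq, true_and]
    by_contra hb
    have : b' = !b := by cases b <;> cases b' <;> simp_all
    subst this
    exact h3 hq

/-- A Lovász–Kneser type bound: the graph on the cube joining points at distance at least `n - k`
is not `k`-colourable. -/
theorem exists_monochromatic_of_hammingNorm {n k K : ℕ} (hK : K ≤ k) (hk : k < n)
    (c : (Fin n → ZMod 2) → Fin K) :
    ∃ x t, n - k ≤ hammingNorm t ∧ c x = c (x + t) := by
  by_contra! hc
  have key : ∀ X Y, IsSignVector n X → IsSignVector n Y → X ⊆ Y → n - k ≤ X.card →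
      c (positiveVector n X) ≠ c (positiveVector n (antipode Y)) := by
    intro X Y hX hY h hcard heq
    refine hc (positiveVector n X) (positiveVector n X + positiveVector n (antipode Y))
      (hcard.trans (card_le_hammingNorm_positiveVector hX hY h)) ?_
    rw [← add_assoc, show positiveVector n X + positiveVector n X = 0 from
      funext fun i => CharTwo.add_self_eq_zero _, zero_add, heq]
  -- Small sets get their size as absolute value and an arbitrary antipodal sign. Large ones get the
  -- smaller colour of their positive and negative parts, shifted past the small values, with the
  -- sign telling which part has it.
  let label : SignedSet → ℕ := fun X =>
    if X.card < n - k then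
      Nat.bit (decide (Encodable.encode X < Encodable.encode (antipode X))) (X.card - 1)
    else
      Nat.bit (decide (c (positiveVector n X) < c (positiveVector n (antipode X))))
        (n - k - 1 + min (c (positiveVector n X) : ℕ) (c (positiveVector n (antipode X))))
  have small : ∀ X, X.card < n - k → label X =
      Nat.bit (decide (Encodable.encode X < Encodable.encode (antipode X))) (X.card - 1) :=
    fun X h => if_pos h
  have large : ∀ X, ¬ X.card < n - k → label X =
      Nat.bit (decide (c (positiveVector n X) < c (positiveVector n (antipode X))))
        (n - k - 1 + min (c (positiveVector n X) : ℕ) (c (positiveVector n (antipode X)))) :=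
    fun X h => if_neg h
  have hflip : ∀ {a b : ℕ}, a ≠ b → (!decide (a < b)) = decide (b < a) := by
    intro a b hab
    by_cases h : a < b
    · simp [h, h.le]
    · simp [h, lt_of_le_of_ne (not_lt.1 h) hab.symm]
  have := tucker n (n - k - 1 + K) label ?_ ?_ ?_
  · omega
  · intro X hX
    by_cases h : X.card < n - k
    · rw [small X h, small _ (by rwa [card_antipode]), antipode_antipode, card_antipode]
      simp only [flipParity, Nat.bodd_bit, Nat.div2_bit]
      rw [hflip]
      intro he
      obtain ⟨p, hp⟩ := hX.nonempty
      have he := Encodable.encode_injective he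
      exact hX.consistent p hp (mem_antipode.1 (he ▸ hp))
    · rw [large X h, large _ (by rwa [card_antipode]), antipode_antipode]
      simp only [flipParity, Nat.bodd_bit, Nat.div2_bit]
      rw [min_comm]
      simp only [Fin.lt_def]
      rw [hflip]
      exact fun he => key X X hX hX subset_rfl (not_lt.1 h) (Fin.ext he)
  · intro X Y hX hY hXY hd
    have hcX : 0 < X.card := hX.nonempty.card_pos
    have hcY : X.card ≤ Y.card := Finset.card_le_card hXY
    by_cases h : Y.card < n - k
    · rw [small X (by omega), small Y h] at hd ⊢
      simp only [Nat.div2_bit] at hd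
      rw [Finset.eq_of_subset_of_card_le hXY (by omega)]
    · rw [large Y h] at hd ⊢
      by_cases h' : X.card < n - k
      · rw [small X h'] at hd
        simp only [Nat.div2_bit] at hd
        omega
      · rw [large X h'] at hd ⊢
        -- Equal minima with opposite signs would give a part of `X` the colour of the opposite part
        -- of `Y`, at distance at least `n - k`.
        have k1 := key X Y hX hY hXY (not_lt.1 h')
        have k2 := key (antipode X) (antipode Y) hX.antipode hY.antipode (antipode_subset hXY)
          (by rw [card_antipode]; exact not_lt.1 h')
        rw [antipode_antipode] at k2
        simp only [Nat.div2_bit] at hd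
        rw [hd]
        congr 1
        simp only [Fin.lt_def, ne_eq, Fin.ext_iff] at *
        rw [decide_eq_decide]
        omega
  · intro X hX
    by_cases h : X.card < n - k
    · rw [small X h, Nat.div2_bit]
      have := hX.nonempty.card_pos
      omega
    · rw [large X h, Nat.div2_bit]
      have := (c (positiveVector n X)).2
      omega

/-- A layer of the `2m`-cube has density at most `1 / √(2m + 1)`; this form stays in `ℕ` and is
inductive. -/
lemma centralBinom_sq_mul_le (m : ℕ) : m.centralBinom ^ 2 * (2 * m + 1) ≤ 16 ^ m := by
  induction m with
  | zero => simp
  | succ m ih =>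
    have h := Nat.succ_mul_centralBinom_succ m
    have h1 : (m + 1) ^ 2 * ((m + 1).centralBinom ^ 2 * (2 * (m + 1) + 1)) ≤
        (m + 1) ^ 2 * 16 ^ (m + 1) := by
      calc (m + 1) ^ 2 * ((m + 1).centralBinom ^ 2 * (2 * (m + 1) + 1))
          = ((m + 1) * (m + 1).centralBinom) ^ 2 * (2 * m + 3) := by ring
        _ = (m.centralBinom ^ 2 * (2 * m + 1)) * (4 * (2 * m + 1) * (2 * m + 3)) := by rw [h]; ring
        _ ≤ 16 ^ m * ((m + 1) ^ 2 * 16) := by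
          refine Nat.mul_le_mul ih ?_
          nlinarith
        _ = _ := by ring
    exact Nat.le_of_mul_le_mul_left h1 (by positivity)

lemma card_hammingNorm_eq_le (n w : ℕ) :
    (Finset.univ.filter fun y : Fin n → ZMod 2 => hammingNorm y = w).card ≤ n.choose w := by
  rw [← Finset.card_fin n, ← Finset.card_powersetCard, Finset.card_fin]
  refine Finset.card_le_card_of_injOn (fun y => Finset.univ.filter fun i => y i ≠ 0) ?_ ?_
  · intro y hy
    simp only [Finset.coe_filter, Finset.mem_univ, true_and, Set.mem_ofPred_eq] at hy
    rw [Finset.mem_coe, Finset.mem_powersetCard]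
    exact ⟨Finset.subset_univ _, hy⟩
  · intro y _ z _ h
    funext i
    have hi : y i ≠ 0 ↔ z i ≠ 0 := by
      have := Finset.ext_iff.1 h i
      simpa using this
    have : ∀ a b : ZMod 2, (a ≠ 0 ↔ b ≠ 0) → a = b := by decide
    exact this _ _ hi

lemma card_hammingNorm_mem_le (m : ℕ) (W : Finset ℕ) :
    (Finset.univ.filter fun y : Fin (2 * m) → ZMod 2 => hammingNorm y ∈ W).card ≤
      W.card * m.centralBinom := by
  have : (Finset.univ.filter fun y : Fin (2 * m) → ZMod 2 => hammingNorm y ∈ W) ⊆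
      W.biUnion fun w => Finset.univ.filter fun y => hammingNorm y = w := by
    intro y hy
    simpa using hy
  refine (Finset.card_le_card this).trans (Finset.card_biUnion_le.trans ?_)
  rw [← smul_eq_mul]
  refine Finset.sum_le_card_nsmul _ _ _ fun w _ => ?_
  exact (card_hammingNorm_eq_le _ _).trans (Nat.choose_le_centralBinom w m)

lemma exists_centralBinom_le (k : ℕ) {δ : ℝ} (hδ : 0 < δ) :
    ∃ N : ℕ, ∀ m ≥ N, (k : ℝ) * m.centralBinom ≤ δ * 4 ^ m := by
  obtain ⟨N, hN⟩ := exists_nat_ge ((k / δ) ^ 2)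
  refine ⟨N, fun m hm => ?_⟩
  have h1 : ((m.centralBinom : ℝ)) ^ 2 * (2 * m + 1) ≤ 16 ^ m := by
    exact_mod_cast centralBinom_sq_mul_le m
  have h2 : (k : ℝ) ^ 2 ≤ δ ^ 2 * (2 * m + 1) := by
    rw [div_pow, div_le_iff₀ (by positivity)] at hN
    have : (N : ℝ) ≤ m := by exact_mod_cast hm
    nlinarith [sq_nonneg δ, mul_nonneg (sq_nonneg δ) (sub_nonneg.2 this),
      mul_nonneg (sq_nonneg δ) (Nat.cast_nonneg (α := ℝ) m)]
  refine le_of_sq_le_sq ?_ (by positivity)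
  have h3 : (0 : ℝ) < 2 * m + 1 := by positivity
  refine le_of_mul_le_mul_right ?_ h3
  calc ((k : ℝ) * m.centralBinom) ^ 2 * (2 * m + 1)
      = (k : ℝ) ^ 2 * ((m.centralBinom : ℝ) ^ 2 * (2 * m + 1)) := by ring
    _ ≤ (δ ^ 2 * (2 * m + 1)) * 16 ^ m := by gcongr
    _ = (δ * 4 ^ m) ^ 2 * (2 * m + 1) := by
      rw [show (16 : ℝ) = 4 ^ 2 by norm_num, ← pow_mul, mul_pow, ← pow_mul, mul_comm 2 m]; ring

/-- A set `t` of steps in the cube whose Cayley graph is not `K`-colourable, and a set `good`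
of almost full measure on which every step flips the bit `bit` and misses the point `hole`. -/
structure CubePiece (K : ℕ) (δ : ℝ) where
  dim : ℕ
  dim_pos : 0 < dim
  steps : Set (Fin dim → ZMod 2)
  good : Set (Fin dim → ZMod 2)
  bit : (Fin dim → ZMod 2) → Bool
  hole : Fin dim → ZMod 2
  exists_monochromatic : ∀ c : (Fin dim → ZMod 2) → Fin K, ∃ x, ∃ t ∈ steps, c x = c (x + t)
  -- An element of `G₂` vanishes on almost every block, so `0` must be good, and its bit unset for
  -- the twist to be a finite sum.
  zero_mem : 0 ∈ good
  bit_zero : bit 0 = false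
  bit_add : ∀ y ∈ good, ∀ t ∈ steps, bit (y + t) = !bit y
  add_ne_hole : ∀ y ∈ good, ∀ t ∈ steps, y + t ≠ hole
  ne_hole : ∀ y ∈ good, y ≠ hole
  card_compl_le : (goodᶜ.ncard : ℝ) ≤ δ * 2 ^ dim

lemma hammingNorm_add_le {n : ℕ} (x y : Fin n → ZMod 2) :
    hammingNorm (x + y) ≤ hammingNorm x + hammingNorm y := by
  have h := hammingDist_triangle (-x) 0 y
  rw [hammingDist_zero_right, hammingDist_zero_left, hammingDist_eq_hammingNorm, neg_neg] at h
  rwa [show -x = x from funext fun i => CharTwo.neg_eq (x i)] at h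

lemma hammingNorm_add_one {n : ℕ} (x : Fin n → ZMod 2) :
    hammingNorm x + hammingNorm (x + 1) = n := by
  have h : ∀ a : ZMod 2, a + 1 ≠ 0 ↔ ¬ a ≠ 0 := by decide
  have := Finset.card_filter_add_card_filter_not (s := (Finset.univ : Finset (Fin n)))
    (fun i => x i ≠ 0)
  rw [Finset.card_fin] at this
  simpa only [hammingNorm, Pi.add_apply, Pi.one_apply, h] using this

lemma hammingNorm_single {n : ℕ} (i : Fin n) :
    hammingNorm (Pi.single i 1 : Fin n → ZMod 2) = 1 := by
  rw [hammingNorm, Finset.card_eq_one]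
  exact ⟨i, by ext j; simp [Pi.single_apply]⟩

theorem nonempty_cubePiece (K : ℕ) {δ : ℝ} (hδ : 0 < δ) : Nonempty (CubePiece K δ) := by
  -- At most `3K + 4` weights are bad: the weight `1` of the hole, `K + 2` at the top and `2K + 1`
  -- around the middle.
  obtain ⟨N, hN⟩ := exists_centralBinom_le (3 * K + 4) hδ
  set m := N + 2 * K + 2 with hm
  set n := 2 * m with hn
  -- The complement of `y + t` differs from `y` in at most `K` coordinates.
  have hflip : ∀ y t : Fin n → ZMod 2, n - K ≤ hammingNorm t → ∃ w : ℕ,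
      hammingNorm (y + t) + w = n ∧ w ≤ hammingNorm y + K ∧ hammingNorm y ≤ w + K := by
    intro y t ht
    have e2 : ∀ x : Fin n → ZMod 2, x + x = 0 := fun x => by
      funext i; exact CharTwo.add_self_eq_zero (x i)
    have h1 := hammingNorm_add_one t
    have h2 := hammingNorm_add_one (y + t)
    have h3 := hammingNorm_add_le y (t + 1)
    have h4 := hammingNorm_add_le (y + t + 1) (t + 1)
    rw [show y + t + 1 + (t + 1) = y by linear_combination e2 t + e2 1] at h4
    rw [← add_assoc] at h3
    exact ⟨hammingNorm (y + t + 1), h2, by omega, by omega⟩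
  have hpos : 0 < n := by omega
  refine ⟨⟨n, hpos, {t | n - K ≤ hammingNorm t}, {y | hammingNorm y ≠ 1 ∧
    hammingNorm y < n - K - 1 ∧ (hammingNorm y < m - K ∨ m + K < hammingNorm y)},
    fun y => decide (n < 2 * hammingNorm y), Pi.single ⟨0, hpos⟩ 1, ?_, ?_, ?_, ?_, ?_, ?_, ?_⟩⟩
  · intro c
    obtain ⟨x, t, ht, h⟩ := exists_monochromatic_of_hammingNorm (le_refl K) (by omega) c
    exact ⟨x, t, ht, h⟩
  · simp only [Set.mem_ofPred_eq, hammingNorm_zero]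
    omega
  · simp
  · rintro y ⟨-, -, hy⟩ t ht
    obtain ⟨w, h1, h2, h3⟩ := hflip y t ht
    by_cases h : n < 2 * hammingNorm y
    · simp only [h, decide_true, Bool.not_true, decide_eq_false_iff_not]
      omega
    · simp only [h, decide_false, Bool.not_false, decide_eq_true_eq]
      omega
  · rintro y ⟨-, hy, -⟩ t ht h
    obtain ⟨w, h1, h2, h3⟩ := hflip y t ht
    rw [h, hammingNorm_single] at h1
    omega
  · rintro y ⟨hy, -, -⟩ rfl
    exact hy (hammingNorm_single _)
  · have hsub : {y : Fin n → ZMod 2 | hammingNorm y ≠ 1 ∧ hammingNorm y < n - K - 1 ∧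
        (hammingNorm y < m - K ∨ m + K < hammingNorm y)}ᶜ ⊆
        ((Finset.univ.filter fun y : Fin (2 * m) → ZMod 2 => hammingNorm y ∈
          insert 1 (Finset.Icc (n - K - 1) n ∪ Finset.Icc (m - K) (m + K)) :
            Finset (Fin (2 * m) → ZMod 2)) : Set (Fin (2 * m) → ZMod 2)) := by
      intro y hy
      have : hammingNorm y ≤ n := by simpa using hammingNorm_le_card_fintype (x := y)
      simp only [Set.mem_compl_iff, Set.mem_ofPred_eq] at hy
      simp only [Finset.coe_filter, Finset.mem_univ, true_and, Finset.mem_insert,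
        Finset.mem_union, Finset.mem_Icc]
      change hammingNorm y = 1 ∨ _
      omega
    have h1 := Set.ncard_le_ncard hsub (Finset.finite_toSet _)
    rw [Set.ncard_coe_finset] at h1
    have h2 := h1.trans (card_hammingNorm_mem_le m _)
    have h3 : (insert 1 (Finset.Icc (n - K - 1) n ∪ Finset.Icc (m - K) (m + K))).card ≤
        3 * K + 4 := by
      refine (Finset.card_insert_le _ _).trans ?_
      have := Finset.card_union_le (Finset.Icc (n - K - 1) n) (Finset.Icc (m - K) (m + K))
      simp only [Nat.card_Icc] at this
      omega
    have h4 := h2.trans (Nat.mul_le_mul_right _ h3)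
    have h5 := hN m (by omega)
    rw [hn, pow_mul]
    norm_num only at h5 ⊢
    refine le_trans ?_ h5
    exact_mod_cast h4

end HammingCube

/-! ### Upper Banach density along subgroups -/

section Density

lemma ncard_inter_div_le_one {G : Type*} (A : Set G) (Φ : Finset G) :
    ((A ∩ (Φ : Set G)).ncard : ℝ) / (Φ.card : ℝ) ≤ 1 := by
  refine div_le_one_of_le₀ ?_ (Nat.cast_nonneg _)
  have := Set.ncard_le_ncard (Set.inter_subset_right (s := A) (t := (Φ : Set G)))
    (Finset.finite_toSet Φ)
  rw [Set.ncard_coe_finset] at this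
  exact_mod_cast this

lemma upperDensity_le_of_eventually {G : Type*} {Φ : ℕ → Finset G} {A : Set G} {c : ℝ}
    (h : ∀ᶠ n in Filter.atTop, ((A ∩ (Φ n : Set G)).ncard : ℝ) / ((Φ n).card : ℝ) ≤ c) :
    upperDensity Φ A ≤ c :=
  Filter.limsup_le_of_le
    (Filter.isCoboundedUnder_le_of_le _ (x := 0) fun _ => by positivity) h

variable {G : Type*} [AddCommGroup G]

lemma le_upperBanachDensity {Φ : ℕ → Finset G} (hΦ : IsFolnerSeq Φ) {A : Set G} {c : ℝ}
    (h : ∀ n, c ≤ ((A ∩ (Φ n : Set G)).ncard : ℝ) / ((Φ n).card : ℝ)) :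
    c ≤ upperBanachDensity A := by
  have hbdd : BddAbove {d : ℝ | ∃ Φ : ℕ → Finset G, IsFolnerSeq Φ ∧ upperDensity Φ A = d} := by
    refine ⟨1, ?_⟩
    rintro d ⟨Φ, -, rfl⟩
    exact upperDensity_le_of_eventually (.of_forall fun n => ncard_inter_div_le_one A (Φ n))
  refine le_trans ?_ (le_csSup hbdd ⟨Φ, hΦ, rfl⟩)
  exact Filter.le_limsup_of_frequently_le (Filter.Frequently.of_forall h)
    (Filter.isBoundedUnder_of ⟨1, fun n => ncard_inter_div_le_one A (Φ n)⟩)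

lemma isFolnerSeq_of_addSubgroup {F : ℕ → AddSubgroup G} {Φ : ℕ → Finset G}
    (hΦ : ∀ n, (Φ n : Set G) = F n) (h : ∀ g, ∃ t, ∀ n ≥ t, g ∈ F n) : IsFolnerSeq Φ := by
  intro g
  obtain ⟨t, ht⟩ := h g
  refine tendsto_const_nhds.congr' ?_
  filter_upwards [Filter.eventually_ge_atTop t] with n hn
  have h1 : (Φ n : Set G) + {g} = Φ n := by
    rw [hΦ]
    ext x
    simp only [Set.add_singleton, Set.image_add_right, Set.mem_preimage, SetLike.mem_coe]
    exact (F n).add_mem_cancel_right ((F n).neg_mem (ht n hn))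
  have h2 : (Φ n).Nonempty := by
    rw [← Finset.coe_nonempty, hΦ]
    exact ⟨0, (F n).zero_mem⟩
  rw [h1, Set.inter_self, Set.ncard_coe_finset, div_self]
  exact_mod_cast h2.card_pos.ne'

end Density

/-! ### Block decomposition and the triangular twist -/

section Blocks

variable {d : ℕ → ℕ} (φ : ℕ ≃ Σ i, Fin (d i))

/-- Restriction to the coordinates in the block `i`. -/
def blockProj (i : ℕ) : G₂ →+ (Fin (d i) → ZMod 2) where
  toFun x a := x (φ.symm ⟨i, a⟩)
  map_zero' := by ext; simp
  map_add' x y := by ext; simp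

/-- Extension by zero from the coordinates in the block `i`. -/
def blockEmb (i : ℕ) : (Fin (d i) → ZMod 2) →+ G₂ where
  toFun v := ∑ a, DirectSum.of (fun _ : ℕ => ZMod 2) (φ.symm ⟨i, a⟩) (v a)
  map_zero' := by simp
  map_add' x y := by simp [Finset.sum_add_distrib]

lemma blockProj_emb (i : ℕ) (v : Fin (d i) → ZMod 2) : blockProj φ i (blockEmb φ i v) = v := by
  funext a
  simp only [blockProj, blockEmb, AddMonoidHom.coe_mk, ZeroHom.coe_mk, DirectSum.sum_apply]
  rw [Finset.sum_eq_single a]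
  · rw [DirectSum.of_eq_same]
  · intro b _ hb
    refine DirectSum.of_eq_of_ne _ _ _ fun h => hb ?_
    simpa using h.symm
  · simp

lemma blockProj_emb_of_ne {i j : ℕ} (h : j ≠ i) (v : Fin (d i) → ZMod 2) :
    blockProj φ j (blockEmb φ i v) = 0 := by
  funext a
  simp only [blockProj, blockEmb, AddMonoidHom.coe_mk, ZeroHom.coe_mk, DirectSum.sum_apply]
  refine Finset.sum_eq_zero fun b _ => DirectSum.of_eq_of_ne _ _ _ fun h' => h ?_
  have := φ.symm.injective h'
  simp only [Sigma.mk.injEq] at this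
  exact this.1

lemma eq_of_blockProj_eq {x y : G₂} (h : ∀ i, blockProj φ i x = blockProj φ i y) : x = y := by
  refine DFinsupp.ext fun n => ?_
  have := congrFun (h (φ n).1) (φ n).2
  simpa [blockProj] using this

/-- The elements vanishing on the blocks `i ≥ t`. -/
def blockLevel (t : ℕ) : AddSubgroup G₂ where
  carrier := {x | ∀ i, t ≤ i → blockProj φ i x = 0}
  zero_mem' i _ := map_zero _
  add_mem' hx hy i hi := by rw [map_add, hx i hi, hy i hi, add_zero]
  neg_mem' hx i hi := by rw [map_neg, hx i hi, neg_zero]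

lemma blockLevel_mono {s t : ℕ} (h : s ≤ t) : blockLevel φ s ≤ blockLevel φ t :=
  fun _ hx i hi => hx i (h.trans hi)

lemma exists_mem_blockLevel (x : G₂) : ∃ t, x ∈ blockLevel φ t := by
  refine ⟨(DFinsupp.support x).sup (fun n => (φ n).1 + 1), fun i hi => ?_⟩
  funext a
  by_contra h
  have hm : φ.symm ⟨i, a⟩ ∈ DFinsupp.support x := DFinsupp.mem_support_iff.2 h
  have := (Finset.le_sup (f := fun n => (φ n).1 + 1) hm).trans hi
  simp at this

lemma blockEmb_mem_blockLevel {i t : ℕ} (h : i < t) (v : Fin (d i) → ZMod 2) :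
    blockEmb φ i v ∈ blockLevel φ t :=
  fun j hj => blockProj_emb_of_ne φ (by omega) v

lemma finite_blockLevel (t : ℕ) : (blockLevel φ t : Set G₂).Finite := by
  refine Set.Finite.of_finite_image (f := fun x => fun i : Fin t => blockProj φ i x)
    (Set.toFinite _) ?_
  intro x hx y hy h
  refine eq_of_blockProj_eq φ fun i => ?_
  by_cases hi : i < t
  · exact congrFun h ⟨i, hi⟩
  · rw [hx i (not_lt.1 hi), hy i (not_lt.1 hi)]

variable (bit : ∀ i, (Fin (d i) → ZMod 2) → Bool) (g : ℕ → G₂)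

/-- The triangular transformation adding `g i` to the points whose `i`-th bit is set. -/
noncomputable def twist (y : G₂) : G₂ :=
  y + ∑ᶠ i, if bit i (blockProj φ i y) then g i else 0

variable {bit g}

lemma twist_eq_sum (hbit : ∀ i, bit i 0 = false) {y : G₂} {s : ℕ} (hy : y ∈ blockLevel φ s) :
    twist φ bit g y = y + ∑ i ∈ Finset.range s, if bit i (blockProj φ i y) then g i else 0 := by
  rw [twist, finsum_eq_sum_of_support_subset]
  intro i hi
  rw [Finset.coe_range, Set.mem_Iio]
  by_contra h
  rw [Function.mem_support, hy i (not_lt.1 h), hbit] at hi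
  simp at hi

lemma exists_common_blockLevel (x y : G₂) : ∃ s, x ∈ blockLevel φ s ∧ y ∈ blockLevel φ s := by
  obtain ⟨s, hs⟩ := exists_mem_blockLevel φ x
  obtain ⟨t, ht⟩ := exists_mem_blockLevel φ y
  exact ⟨max s t, blockLevel_mono φ (le_max_left _ _) hs, blockLevel_mono φ (le_max_right _ _) ht⟩

/-- Triangularity: `g i` vanishes on block `t` when `i ≤ t`, so the correction in block `t` is
determined by the later blocks. -/
lemma blockProj_twist_sub (hbit : ∀ i, bit i 0 = false) (hg : ∀ i, g i ∈ blockLevel φ i)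
    {y y' : G₂} {t : ℕ} (h : ∀ i, t < i → blockProj φ i y = blockProj φ i y') :
    blockProj φ t (twist φ bit g y) - blockProj φ t y =
      blockProj φ t (twist φ bit g y') - blockProj φ t y' := by
  obtain ⟨s, hy, hy'⟩ := exists_common_blockLevel φ y y'
  rw [twist_eq_sum φ hbit hy, twist_eq_sum φ hbit hy', map_add, map_add, add_sub_cancel_left,
    add_sub_cancel_left, map_sum, map_sum]
  refine Finset.sum_congr rfl fun i _ => ?_
  by_cases hi : t < i
  · rw [h i hi]
  · have := hg i t (not_lt.1 hi)
    split_ifs <;> simp [this]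

/-- Decoding runs downwards from a block beyond which both points vanish. -/
lemma blockProj_eq_of_twist (hbit : ∀ i, bit i 0 = false) (hg : ∀ i, g i ∈ blockLevel φ i)
    {y y' : G₂} {t : ℕ}
    (h : ∀ i, t ≤ i → blockProj φ i (twist φ bit g y) = blockProj φ i (twist φ bit g y')) :
    ∀ i, t ≤ i → blockProj φ i y = blockProj φ i y' := by
  obtain ⟨s, hy, hy'⟩ := exists_common_blockLevel φ y y'
  suffices H : ∀ k i, t ≤ i → s ≤ i + k → blockProj φ i y = blockProj φ i y' from
    fun i hi => H s i hi (by omega)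
  intro k
  induction k with
  | zero => intro i _ hs; rw [hy i hs, hy' i hs]
  | succ k ih =>
    intro i hi hs
    have := blockProj_twist_sub φ hbit hg fun j (hj : i < j) => ih j (by omega) (by omega)
    rw [h i hi] at this
    exact sub_right_injective this

lemma twist_injective (hbit : ∀ i, bit i 0 = false) (hg : ∀ i, g i ∈ blockLevel φ i) :
    Function.Injective (twist φ bit g) := fun y y' h =>
  eq_of_blockProj_eq φ fun i =>
    blockProj_eq_of_twist φ hbit hg (t := 0) (fun j _ => by rw [h]) i (Nat.zero_le i)

lemma twist_mem_blockLevel (hbit : ∀ i, bit i 0 = false) (hg : ∀ i, g i ∈ blockLevel φ i)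
    {y : G₂} {s : ℕ} (hy : y ∈ blockLevel φ s) : twist φ bit g y ∈ blockLevel φ s := by
  rw [twist_eq_sum φ hbit hy]
  refine add_mem hy (sum_mem fun i hi => ?_)
  split_ifs
  · exact blockLevel_mono φ (Finset.mem_range.1 hi).le (hg i)
  · exact zero_mem _

lemma twist_surjective (hbit : ∀ i, bit i 0 = false) (hg : ∀ i, g i ∈ blockLevel φ i) :
    Function.Surjective (twist φ bit g) := by
  intro x
  obtain ⟨s, hs⟩ := exists_mem_blockLevel φ x
  have hmaps : Set.MapsTo (twist φ bit g) (blockLevel φ s) (blockLevel φ s) :=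
    fun y hy => twist_mem_blockLevel φ hbit hg hy
  obtain ⟨y, -, hy⟩ := ((Set.Finite.injOn_iff_bijOn_of_mapsTo (finite_blockLevel φ s) hmaps).1
    (twist_injective φ hbit hg).injOn).surjOn hs
  exact ⟨y, hy⟩

lemma G₂.add_self (x : G₂) : x + x = 0 :=
  DFinsupp.ext fun n => by simp [CharTwo.add_self_eq_zero]

lemma twist_add_blockEmb (hbit : ∀ i, bit i 0 = false) {y : G₂} {i : ℕ} {v : Fin (d i) → ZMod 2}
    (h : bit i (blockProj φ i y + v) = !bit i (blockProj φ i y)) :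
    twist φ bit g (y + blockEmb φ i v) = twist φ bit g y + blockEmb φ i v + g i := by
  obtain ⟨s, hy⟩ := exists_mem_blockLevel φ y
  have hy₁ : y ∈ blockLevel φ (max s (i + 1)) := blockLevel_mono φ (le_max_left _ _) hy
  have hv : blockEmb φ i v ∈ blockLevel φ (max s (i + 1)) :=
    blockEmb_mem_blockLevel φ (lt_of_lt_of_le (Nat.lt_succ_self i) (le_max_right _ _)) v
  rw [twist_eq_sum φ hbit hy₁, twist_eq_sum φ hbit (add_mem hy₁ hv)]
  have hterm : ∀ j ∈ Finset.range (max s (i + 1)),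
      (if bit j (blockProj φ j (y + blockEmb φ i v)) then g j else 0) =
        (if bit j (blockProj φ j y) then g j else 0) + if i = j then g i else 0 := by
    intro j _
    rw [map_add]
    by_cases hj : i = j
    · subst hj
      rw [blockProj_emb, h, if_pos rfl]
      cases bit i (blockProj φ i y) <;> simp [G₂.add_self]
    · rw [blockProj_emb_of_ne φ (Ne.symm hj), add_zero, if_neg hj, add_zero]
  rw [Finset.sum_congr rfl hterm, Finset.sum_add_distrib, Finset.sum_ite_eq, if_pos
    (Finset.mem_range.2 (lt_of_lt_of_le (Nat.lt_succ_self i) (le_max_right _ _)))]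
  abel

/-- Changing block `t` of `x` and the blocks below it leaves the later blocks of the preimage fixed,
hence also the correction in block `t`. So one `f` puts `e` there for all `h` at once. -/
lemma exists_blockEmb_twist (hbit : ∀ i, bit i 0 = false) (hg : ∀ i, g i ∈ blockLevel φ i)
    (t : ℕ) (x : G₂) (e : Fin (d t) → ZMod 2) : ∃ f ∈ blockLevel φ (t + 1), ∀ h ∈ blockLevel φ t,
      ∃ y, twist φ bit g y = x + f + h ∧ blockProj φ t y = e := by
  obtain ⟨y, rfl⟩ := twist_surjective φ hbit hg x
  refine ⟨blockEmb φ t (e - blockProj φ t y), blockEmb_mem_blockLevel φ (Nat.lt_succ_self t) _,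
    fun h hh => ?_⟩
  obtain ⟨z, hz⟩ := twist_surjective φ hbit hg
    (twist φ bit g y + blockEmb φ t (e - blockProj φ t y) + h)
  refine ⟨z, hz, ?_⟩
  have hyz : ∀ i, t + 1 ≤ i → blockProj φ i z = blockProj φ i y := by
    refine blockProj_eq_of_twist φ hbit hg fun i hi => ?_
    rw [hz, map_add, map_add, blockProj_emb_of_ne φ (by omega), hh i (by omega), add_zero, add_zero]
  have h1 := blockProj_twist_sub φ hbit hg (t := t) fun i hi => hyz i hi
  rw [hz, map_add, map_add, blockProj_emb, hh t le_rfl] at h1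
  linear_combination -h1

/-- Equidistribution of block `i`: trade its content against an arbitrary `v`, which is an injective
operation on pairs. -/
lemma ncard_blockProj_mem_mul_le {i t : ℕ} (hi : i < t) (D : Set (Fin (d i) → ZMod 2)) :
    {y | y ∈ blockLevel φ t ∧ blockProj φ i y ∈ D}.ncard * 2 ^ d i ≤
      D.ncard * (blockLevel φ t : Set G₂).ncard := by
  have hH : (Set.univ : Set (Fin (d i) → ZMod 2)).ncard = 2 ^ d i := by
    rw [Set.ncard_univ, Nat.card_eq_fintype_card]
    simp [ZMod.card]
  rw [← hH, ← Set.ncard_prod, ← Set.ncard_prod]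
  refine Set.ncard_le_ncard_of_injOn (fun p => (blockProj φ i p.1,
    p.1 - blockEmb φ i (blockProj φ i p.1) + blockEmb φ i p.2)) ?_ ?_
    ((Set.toFinite D).prod (finite_blockLevel φ t))
  · rintro ⟨y, v⟩ ⟨⟨hy, hD⟩, -⟩
    exact ⟨hD, add_mem (sub_mem hy (blockEmb_mem_blockLevel φ hi _))
      (blockEmb_mem_blockLevel φ hi _)⟩
  · rintro ⟨y, v⟩ - ⟨z, w⟩ - h
    simp only [Prod.mk.injEq] at h ⊢
    obtain ⟨h1, h2⟩ := h
    have h3 := congrArg (blockProj φ i) h2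
    simp only [map_add, map_sub, blockProj_emb, sub_self, zero_add] at h3
    rw [h1, h3] at h2
    exact ⟨by simpa using h2, h3⟩

end Blocks

/-! ### Construction of the sets -/

/-- The Cayley graph of `S` has infinite chromatic number: for every finite colouring of `G` some `x` and `x + s`
with `s ∈ S` have the same colour. -/
def IsChromaticallyRecurrent {G : Type*} [AddCommGroup G] (S : Set G) : Prop :=
  ∀ (K : ℕ) (c : G → Fin K), ∃ x, ∃ s ∈ S, c x = c (x + s)

lemma exists_seq_infinitely_often {d : ℕ → ℕ} (φ : ℕ ≃ Σ i, Fin (d i)) :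
    ∃ g : ℕ → G₂, (∀ i, g i ∈ blockLevel φ i) ∧ ∀ u K, ∃ i, K ≤ i ∧ g i = u := by
  classical
  have : Countable G₂ := by
    have : Countable (Π₀ _ : ℕ, ZMod 2) := inferInstance
    exact this
  obtain ⟨q, hq⟩ := exists_surjective_nat G₂
  -- The first component of `Nat.unpair` takes each value infinitely often; `0` is used while the
  -- enumerated element is not yet supported below block `i`.
  refine ⟨fun i => if q i.unpair.1 ∈ blockLevel φ i then q i.unpair.1 else 0, ?_, ?_⟩
  · intro i
    dsimp only
    split_ifs with h
    · exact h
    · exact zero_mem _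
  · intro u K
    obtain ⟨a, rfl⟩ := hq u
    obtain ⟨t, ht⟩ := exists_mem_blockLevel φ (q a)
    have hle : max K t ≤ Nat.pair a (max K t) := Nat.right_le_pair _ _
    refine ⟨Nat.pair a (max K t), (le_max_left _ _).trans hle, ?_⟩
    simp only [Nat.unpair_pair]
    exact if_pos (blockLevel_mono φ ((le_max_right _ _).trans hle) ht)

/-- The last clause makes `C` thickly syndetic: translates of the subgroup `F t` inside `C` occur
with gaps bounded by `F (t + 1)`. -/
theorem exists_recurrent_dense_disjoint {ε : ℝ} (hε : 0 < ε) :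
    ∃ (S A C : Set G₂) (F : ℕ → AddSubgroup G₂),
      (∀ u : G₂, IsChromaticallyRecurrent (S + {u})) ∧ 1 - ε < upperBanachDensity A ∧
      Disjoint (S + A) C ∧ Monotone F ∧ (∀ t, (F t : Set G₂).Finite) ∧ (∀ x, ∃ t, x ∈ F t) ∧
      ∀ t x, ∃ f ∈ F (t + 1), ∀ h ∈ F t, x + f + h ∈ C := by
  classical
  -- These losses sum to at most `ε / 2`, leaving room for the strict inequality.
  have hδ : ∀ i : ℕ, 0 < ε / 4 * (1 / 2) ^ i := fun i => by positivity
  obtain ⟨p⟩ : Nonempty (∀ i, CubePiece i (ε / 4 * (1 / 2) ^ i)) :=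
    ⟨fun i => (nonempty_cubePiece i (hδ i)).some⟩
  have : Infinite (Σ i, Fin (p i).dim) :=
    Infinite.of_injective (fun i => ⟨i, ⟨0, (p i).dim_pos⟩⟩) fun i j h => (Sigma.mk.inj h).1
  obtain ⟨hden⟩ := nonempty_denumerable (Σ i, Fin (p i).dim)
  let φ : ℕ ≃ Σ i, Fin (p i).dim := (Denumerable.eqv _).symm
  obtain ⟨g, hg, hg'⟩ := exists_seq_infinitely_often φ
  have hbit : ∀ i, (p i).bit 0 = false := fun i => (p i).bit_zero
  set θ := twist φ (fun i => (p i).bit) g with hθ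
  have hinj : Function.Injective θ := twist_injective φ hbit hg
  refine ⟨{s | ∃ i, ∃ v ∈ (p i).steps, s = blockEmb φ i v + g i},
    θ '' {y | ∀ i, blockProj φ i y ∈ (p i).good}, θ '' {y | ∃ i, blockProj φ i y = (p i).hole},
    blockLevel φ, ?_, ?_, ?_, fun s t h => blockLevel_mono φ h, finite_blockLevel φ,
    exists_mem_blockLevel φ, ?_⟩
  · intro u K c
    -- With `g i = u` the shift cancels, so `S + {u}` contains the embedded steps of block `i`,
    -- which defeat `i ≥ K` colours.
    obtain ⟨i, hi, rfl⟩ := hg' u K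
    obtain ⟨x, v, hv, h⟩ := (p i).exists_monochromatic
      fun x => Fin.castLE hi (c (blockEmb φ i x))
    refine ⟨blockEmb φ i x, blockEmb φ i v, ?_, ?_⟩
    · refine Set.mem_add.2 ⟨_, ⟨i, v, hv, rfl⟩, g i, rfl, ?_⟩
      rw [add_assoc, G₂.add_self, add_zero]
    · rw [← map_add]
      exact Fin.castLE_injective hi h
  · have hcoe : ∀ t, ((finite_blockLevel φ t).toFinset : Set G₂) = blockLevel φ t :=
      fun t => Set.Finite.coe_toFinset _
    have hfol : IsFolnerSeq fun t => (finite_blockLevel φ t).toFinset :=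
      isFolnerSeq_of_addSubgroup hcoe fun x => by
        obtain ⟨t, ht⟩ := exists_mem_blockLevel φ x
        exact ⟨t, fun n hn => blockLevel_mono φ hn ht⟩
    refine lt_of_lt_of_le (by linarith : 1 - ε < 1 - ε / 2) (le_upperBanachDensity hfol fun t => ?_)
    set Y : Set G₂ := {y | ∀ i, blockProj φ i y ∈ (p i).good} with hY
    set L : Set G₂ := (blockLevel φ t : Set G₂) with hL
    have hLfin : L.Finite := finite_blockLevel φ t
    rw [hcoe, ← Set.ncard_coe_finset, hcoe]
    have hLpos : (0 : ℝ) < L.ncard := by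
      exact_mod_cast (Set.ncard_pos hLfin).2 ⟨0, (blockLevel φ t).zero_mem⟩
    rw [le_div_iff₀ hLpos]
    have h1 : (Y ∩ L).ncard ≤ (θ '' Y ∩ L).ncard := by
      rw [← Set.ncard_image_of_injective _ hinj]
      refine Set.ncard_le_ncard ?_ (hLfin.subset Set.inter_subset_right)
      rintro _ ⟨y, ⟨hy, hyL⟩, rfl⟩
      exact ⟨⟨y, hy, rfl⟩, twist_mem_blockLevel φ hbit hg hyL⟩
    have h2 : L ⊆ (Y ∩ L) ∪ ⋃ i ∈ Finset.range t,
        {y | y ∈ blockLevel φ t ∧ blockProj φ i y ∈ (p i).goodᶜ} := by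
      intro y hy
      by_cases h : y ∈ Y
      · exact Or.inl ⟨h, hy⟩
      · right
        simp only [hY, Set.mem_ofPred_eq, not_forall] at h
        obtain ⟨i, hi⟩ := h
        simp only [Set.mem_iUnion, Finset.mem_range]
        refine ⟨i, ?_, hy, hi⟩
        by_contra hit
        rw [hy i (not_lt.1 hit)] at hi
        exact hi (p i).zero_mem
    have h3 : L.ncard ≤ (Y ∩ L).ncard + ∑ i ∈ Finset.range t,
        {y | y ∈ blockLevel φ t ∧ blockProj φ i y ∈ (p i).goodᶜ}.ncard := by
      refine (Set.ncard_le_ncard h2 ?_).trans ((Set.ncard_union_le _ _).trans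
        (Nat.add_le_add_left (Finset.set_ncard_biUnion_le _ _) _))
      refine (hLfin.subset Set.inter_subset_right).union (Set.Finite.biUnion
        (Finset.finite_toSet _) fun i _ => hLfin.subset fun y hy => hy.1)
    have h4 : ∀ i ∈ Finset.range t,
        ({y | y ∈ blockLevel φ t ∧ blockProj φ i y ∈ (p i).goodᶜ}.ncard : ℝ) ≤
          ε / 4 * (1 / 2) ^ i * L.ncard := by
      intro i hi
      have hm := ncard_blockProj_mem_mul_le φ (Finset.mem_range.1 hi) (p i).goodᶜ
      have hm' : ({y | y ∈ blockLevel φ t ∧ blockProj φ i y ∈ (p i).goodᶜ}.ncard : ℝ) *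
          2 ^ (p i).dim ≤ (p i).goodᶜ.ncard * L.ncard := by exact_mod_cast hm
      refine le_of_mul_le_mul_right (hm'.trans ?_) (by positivity : (0 : ℝ) < 2 ^ (p i).dim)
      calc ((p i).goodᶜ.ncard : ℝ) * L.ncard
          ≤ (ε / 4 * (1 / 2) ^ i * 2 ^ (p i).dim) * L.ncard := by
            gcongr
            exact (p i).card_compl_le
        _ = _ := by ring
    have h5 : (L.ncard : ℝ) ≤ (Y ∩ L).ncard + ∑ i ∈ Finset.range t,
        ({y | y ∈ blockLevel φ t ∧ blockProj φ i y ∈ (p i).goodᶜ}.ncard : ℝ) := by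
      exact_mod_cast h3
    have h6 := Finset.sum_le_sum h4
    rw [← Finset.sum_mul, ← Finset.mul_sum] at h6
    have h7 := sum_geometric_two_le t
    have h8 : ((Y ∩ L).ncard : ℝ) ≤ (θ '' Y ∩ L).ncard := by exact_mod_cast h1
    have h9 : ε / 4 * (∑ i ∈ Finset.range t, (1 / (2 : ℝ)) ^ i) * L.ncard ≤
        ε / 4 * 2 * L.ncard := by gcongr
    linarith
  · rw [Set.disjoint_left]
    rintro _ hs ⟨z, ⟨j, hj⟩, rfl⟩
    obtain ⟨_, ⟨i, v, hv, rfl⟩, _, ⟨y, hy, rfl⟩, h⟩ := Set.mem_add.1 hs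
    -- The sum is the twist of `y + blockEmb φ i v`, which has no hole: block `i` by `add_ne_hole`,
    -- the others by `ne_hole`.
    have hflip := twist_add_blockEmb φ (g := g) hbit ((p i).bit_add _ (hy i) v hv)
    have : θ (y + blockEmb φ i v) = θ z := by
      rw [← hθ] at hflip
      rw [hflip, ← h]
      abel
    rw [← hinj this, map_add] at hj
    by_cases hij : j = i
    · subst hij
      rw [blockProj_emb] at hj
      exact (p j).add_ne_hole _ (hy j) v hv hj
    · rw [blockProj_emb_of_ne φ hij, add_zero] at hj
      exact (p j).ne_hole _ (hy j) hj
  · intro t x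
    obtain ⟨f, hf, h⟩ := exists_blockEmb_twist φ hbit hg t x (p t).hole
    refine ⟨f, hf, fun u hu => ?_⟩
    obtain ⟨y, hy, he⟩ := h u hu
    exact ⟨y, ⟨t, he⟩, hy⟩

/-! ### From colourings to topological recurrence -/

section Recurrence

variable {G : Type*} [AddCommGroup G]

lemma IsChromaticallyRecurrent.exists_eq_of_finite {S : Set G} (hS : IsChromaticallyRecurrent S)
    {κ : Type*} [Finite κ] (c : G → κ) : ∃ x, ∃ s ∈ S, c x = c (x + s) := by
  obtain ⟨x, s, hs, h⟩ := hS (Nat.card κ) fun x => Finite.equivFin κ (c x)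
  exact ⟨x, s, hs, (Finite.equivFin κ).injective h⟩

/-- By minimality and compactness finitely many translates of `U` cover `X`. Colour `g` by a
translate containing `g +ᵥ x₀`; two elements of one colour differing by `s` give two points of `U`
differing by `s`. -/
lemma IsChromaticallyRecurrent.isSetOfTopologicalRecurrence {S : Set G}
    (hS : IsChromaticallyRecurrent S) : IsSetOfTopologicalRecurrence S := by
  intro X _ _ _ _ _ U hU hne
  obtain ⟨I, hI⟩ := isCompact_univ.exists_finite_cover_vadd G hU hne
  obtain ⟨x₀, -⟩ := hne
  have hc : ∀ g : G, ∃ i : I, (-(i : G) + g) +ᵥ x₀ ∈ U := by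
    intro g
    obtain ⟨i, hi, hx⟩ := Set.mem_iUnion₂.1 (hI (Set.mem_univ (g +ᵥ x₀)))
    refine ⟨⟨i, hi⟩, ?_⟩
    rwa [Set.mem_vadd_set_iff_neg_vadd_mem, vadd_vadd] at hx
  choose c hc using hc
  obtain ⟨x, s, hs, h⟩ := hS.exists_eq_of_finite c
  refine ⟨s, hs, (-(c x : G) + (x + s)) +ᵥ x₀, ?_, ?_⟩
  · rw [h]
    exact hc _
  · rw [Set.mem_vadd_set_iff_neg_vadd_mem, vadd_vadd]
    convert hc x using 2
    abel

end Recurrence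

/-! ### Bohr topology and Bohr compactification of `G₂` -/

section BohrTopology

lemma exists_add_subset_of_isOpen_bohr {G : Type*} [AddCommGroup G] {U : Set G}
    (hU : @IsOpen G (bohrTopology G) U) {u : G} (hu : u ∈ U) :
    ∃ I : Set (G →+ UnitAddCircle), I.Finite ∧ ∀ v, (∀ χ ∈ I, χ v = 0) → u + v ∈ U := by
  have h : U ∈ @nhds G (bohrTopology G) u := @IsOpen.mem_nhds G (bohrTopology G) u U hU hu
  rw [bohrTopology, nhds_iInf, Filter.mem_iInf] at h
  obtain ⟨I, hI, V, hV, rfl⟩ := h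
  refine ⟨I, hI, fun v hv => Set.mem_iInter.2 fun χ => ?_⟩
  have hχ := hV χ
  rw [nhds_induced, Filter.mem_comap] at hχ
  obtain ⟨t, ht, htV⟩ := hχ
  refine htV ?_
  rw [Set.mem_preimage, map_add, hv χ χ.2, add_zero]
  exact mem_of_mem_nhds ht

/-- As `G₂` has exponent two, a character takes values in the finite 2-torsion of the circle. -/
lemma finiteIndex_ker_of_addCircle (χ : G₂ →+ UnitAddCircle) : χ.ker.FiniteIndex := by
  have hfin : {x : UnitAddCircle | 2 • x = 0}.Finite := AddCircle.finite_torsion 1 two_pos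
  have : Finite χ.range := by
    refine Set.Finite.subset hfin ?_
    rintro _ ⟨x, rfl⟩
    rw [Set.mem_ofPred_eq, ← map_nsmul, two_nsmul, G₂.add_self, map_zero]
  exact AddSubgroup.finiteIndex_ker χ

/-- A Bohr neighbourhood in `G₂` contains a coset of a subgroup of finite index. -/
lemma exists_finiteIndex_add_subset {U : Set G₂} (hU : @IsOpen G₂ (bohrTopology G₂) U) {u : G₂}
    (hu : u ∈ U) : ∃ V : AddSubgroup G₂, V.FiniteIndex ∧ ∀ v ∈ V, u + v ∈ U := by
  obtain ⟨I, hI, h⟩ := exists_add_subset_of_isOpen_bohr hU hu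
  have := hI.to_subtype
  have hk : ∀ χ : I, (χ : G₂ →+ UnitAddCircle).ker.FiniteIndex :=
    fun χ => finiteIndex_ker_of_addCircle χ
  refine ⟨⨅ χ : I, (χ : G₂ →+ UnitAddCircle).ker, AddSubgroup.finiteIndex_iInf hk,
    fun v hv => h v fun χ hχ => ?_⟩
  exact AddSubgroup.mem_iInf.1 hv ⟨χ, hχ⟩

lemma isSyndetic_of_isOpen_bohr {U : Set G₂} (hU : @IsOpen G₂ (bohrTopology G₂) U)
    (hne : U.Nonempty) : IsSyndetic U := by
  obtain ⟨u, hu⟩ := hne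
  obtain ⟨V, hV, h⟩ := exists_finiteIndex_add_subset hU hu
  refine ⟨Set.range fun q : G₂ ⧸ V => q.out - u, Set.finite_range _, ?_⟩
  refine Set.eq_univ_of_forall fun g => Set.mem_add.2 ?_
  obtain ⟨q, hq⟩ : ∃ q : G₂ ⧸ V, q = QuotientAddGroup.mk g := ⟨_, rfl⟩
  refine ⟨u + (-q.out + g), h _ ?_, q.out - u, ⟨q, rfl⟩, by abel⟩
  rw [← QuotientAddGroup.eq, QuotientAddGroup.out_eq', hq]

lemma IsPiecewiseBohr.isPiecewiseSyndetic {A : Set G₂} (h : IsPiecewiseBohr A) :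
    IsPiecewiseSyndetic A := by
  obtain ⟨U, hU, hne, h⟩ := h
  exact ⟨U, isSyndetic_of_isOpen_bohr hU hne, h⟩

lemma isBohrDense_of_isChromaticallyRecurrent {S : Set G₂}
    (hS : ∀ u : G₂, IsChromaticallyRecurrent (S + {u})) : IsBohrDense S := by
  let _ := bohrTopology G₂
  refine dense_iff_inter_open.2 fun U hU ⟨u, hu⟩ => ?_
  obtain ⟨V, hV, h⟩ := exists_finiteIndex_add_subset hU hu
  -- Colouring by cosets of `V` yields `s - u ∈ V` with `s ∈ S`, so `s` lies in `u + V ⊆ U`.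
  obtain ⟨x, t, ht, hxt⟩ := (hS (-u)).exists_eq_of_finite
    fun x => (QuotientAddGroup.mk x : G₂ ⧸ V)
  obtain ⟨s, hs, _, rfl, rfl⟩ := Set.mem_add.1 ht
  rw [QuotientAddGroup.eq, neg_add_cancel_left] at hxt
  refine ⟨s, ?_, hs⟩
  simpa using h _ hxt

variable {G : Type*} [AddCommGroup G]

lemma BohrCompactification.denseRange_of : DenseRange (BohrCompactification.of G) := by
  have h : DenseRange (Set.inclusion (bohrEval G).range.le_topologicalClosure) :=
    (denseRange_inclusion_iff _).2 subset_rfl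
  have hs : Function.Surjective (bohrEval G).rangeRestrict :=
    (bohrEval G).rangeRestrict_surjective
  exact h.comp hs.denseRange (continuous_inclusion _)

lemma BohrCompactification.continuous_of :
    @Continuous _ _ (bohrTopology G) _ (BohrCompactification.of G) := by
  let _ := bohrTopology G
  refine continuous_induced_rng.2 (continuous_pi fun χ => ?_)
  exact continuous_iInf_dom (i := χ) continuous_induced_dom

lemma IsBohrDense.haar_closure_pos {S : Set G} (hS : IsBohrDense S) :
    0 < BohrCompactification.haar G (closure (BohrCompactification.of G '' S)) := by
  let _ := bohrTopology G
  have h : Dense (BohrCompactification.of G '' S) :=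
    BohrCompactification.denseRange_of.dense_image BohrCompactification.continuous_of hS
  rw [h.closure_eq]
  have := MeasureTheory.Measure.addHaarMeasure_self
    (K₀ := (⊤ : TopologicalSpace.PositiveCompacts (BohrCompactification G)))
  rw [TopologicalSpace.PositiveCompacts.coe_top] at this
  rw [BohrCompactification.haar, this]
  exact one_pos

end BohrTopology

/-! ### Consequences of missing a thickly syndetic set -/

section ThickComplement

variable {G : Type*} [AddCommGroup G]

lemma not_isPiecewiseSyndetic_of_disjoint {X C : Set G} {F : ℕ → AddSubgroup G}
    (hXC : Disjoint X C) (hmono : Monotone F) (hfin : ∀ t, (F t : Set G).Finite)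
    (hF : ∀ x, ∃ t, x ∈ F t) (hC : ∀ t x, ∃ f ∈ F (t + 1), ∀ h ∈ F t, x + f + h ∈ C) :
    ¬ IsPiecewiseSyndetic X := by
  rintro ⟨B, ⟨E, hE, hBE⟩, hB⟩
  obtain ⟨t, ht⟩ : ∃ t, E ⊆ F t := by
    choose τ hτ using hF
    obtain ⟨t, ht⟩ := (hE.image τ).bddAbove
    exact ⟨t, fun x hx => hmono (ht ⟨x, hx, rfl⟩) (hτ x)⟩
  -- Only this finite piece of `B` is needed: `f ∈ F (t + 1)` is `b + e` with `e ∈ E ⊆ F t`, so `b`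
  -- is in it, and `b + g = g + f - e` lies in both `X` and `C`.
  obtain ⟨g, hg⟩ := hB (B ∩ F (t + 1)) ((hfin _).subset Set.inter_subset_right)
    Set.inter_subset_left
  obtain ⟨f, hf, h⟩ := hC t g
  obtain ⟨b, hb, e, he, hbe⟩ := Set.mem_add.1 (hBE ▸ Set.mem_univ f : f ∈ B + E)
  have hbF : b ∈ F (t + 1) := by
    rw [eq_sub_of_add_eq hbe]
    exact sub_mem hf (hmono (Nat.le_succ t) (ht he))
  refine Set.disjoint_left.1 hXC (hg (Set.add_mem_add ⟨hb, hbF⟩ rfl)) ?_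
  convert h (-e) (neg_mem (ht he)) using 1
  rw [← hbe]
  abel

/-- For each `f`, a point `x ∈ Φ` with `x + f ∉ X` is sent by `f` either into `Φ \ X` or out of `Φ`.
-/
lemma card_le_of_forall_exists_notMem {X : Set G} {F : Finset G} (h : ∀ x, ∃ f ∈ F, x + f ∉ X)
    (Φ : Finset G) : (Φ.card : ℝ) ≤ ∑ f ∈ F, ((Φ.card - (X ∩ (Φ : Set G)).ncard) +
      (Φ.card - (((Φ : Set G) + {f}) ∩ (Φ : Set G)).ncard : ℝ)) := by
  classical
  have h1 : (Φ : Set G) ⊆ ⋃ f ∈ F, {x | x ∈ Φ ∧ x + f ∉ X} := by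
    intro x hx
    obtain ⟨f, hf, hfx⟩ := h x
    exact Set.mem_iUnion₂.2 ⟨f, hf, hx, hfx⟩
  have h2 : (Φ.card : ℝ) ≤ ∑ f ∈ F, ({x | x ∈ Φ ∧ x + f ∉ X}.ncard : ℝ) := by
    rw [← Set.ncard_coe_finset]
    refine (le_trans ?_ (Nat.cast_le.2 (Finset.set_ncard_biUnion_le F fun f => {x | x ∈ Φ ∧ x + f ∉ X}))).trans_eq
      (Nat.cast_sum _ _)
    exact Nat.cast_le.2 <| Set.ncard_le_ncard h1 (Set.Finite.biUnion (Finset.finite_toSet _)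
      fun f _ => (Finset.finite_toSet Φ).subset fun x hx => hx.1)
  refine h2.trans (Finset.sum_le_sum fun f _ => ?_)
  have h3 : {x | x ∈ Φ ∧ x + f ∉ X}.ncard ≤
      ((Φ : Set G) \ (X ∩ Φ)).ncard + (((Φ : Set G) + {f}) \ (((Φ : Set G) + {f}) ∩ Φ)).ncard := by
    refine le_trans ?_ (Set.ncard_union_le _ _)
    rw [← Set.ncard_image_of_injective _ (add_left_injective f)]
    refine Set.ncard_le_ncard ?_ ((Finset.finite_toSet Φ).sdiff.union
      (((Finset.finite_toSet Φ).add (Set.finite_singleton f)).sdiff))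
    rintro _ ⟨x, ⟨hx, hxX⟩, rfl⟩
    by_cases hΦ : x + f ∈ Φ
    · exact Or.inl ⟨hΦ, fun h' => hxX h'.1⟩
    · exact Or.inr ⟨Set.add_mem_add hx rfl, fun h' => hΦ h'.2⟩
  have hfinΦ := (Finset.finite_toSet Φ)
  have h4 := Set.ncard_sdiff_add_ncard_of_subset
    (Set.inter_subset_right (s := X) (t := (Φ : Set G))) hfinΦ
  have h5 := Set.ncard_sdiff_add_ncard_of_subset
    (Set.inter_subset_left (s := (Φ : Set G) + {f}) (t := (Φ : Set G)))
    (hfinΦ.add (Set.finite_singleton f))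
  have h6 : ((Φ : Set G) + {f}).ncard = Φ.card := by
    rw [Set.add_singleton, Set.ncard_image_of_injective _ (add_left_injective f),
      Set.ncard_coe_finset]
  rw [h6] at h5
  rw [Set.ncard_coe_finset] at h4
  have h3' : ({x | x ∈ Φ ∧ x + f ∉ X}.ncard : ℝ) ≤ _ := Nat.cast_le.2 h3
  have h4' : ((((Φ : Set G) \ (X ∩ Φ)).ncard + (X ∩ (Φ : Set G)).ncard : ℕ) : ℝ) = Φ.card :=
    congrArg _ h4
  have h5' : (((((Φ : Set G) + {f}) \ (((Φ : Set G) + {f}) ∩ Φ)).ncard +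
    (((Φ : Set G) + {f}) ∩ Φ).ncard : ℕ) : ℝ) = Φ.card := congrArg _ h5
  push_cast at h3' h4' h5'
  linarith

lemma upperBanachDensity_lt_one {X : Set G} {F : Finset G} (h : ∀ x, ∃ f ∈ F, x + f ∉ X) :
    upperBanachDensity X < 1 := by
  have hF : (1 : ℝ) ≤ F.card := by
    obtain ⟨f, hf, -⟩ := h 0
    exact_mod_cast Finset.card_pos.2 ⟨f, hf⟩
  -- In the limit the complement has density at least `1 / |F|`; half of it absorbs the Følner
  -- error.
  suffices H : upperBanachDensity X ≤ 1 - 1 / (2 * F.card) by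
    have : (0 : ℝ) < 1 / (2 * F.card) := by positivity
    linarith
  refine Real.sSup_le ?_ ?_
  · rintro d ⟨Φ, hΦ, rfl⟩
    refine upperDensity_le_of_eventually ?_
    have hlim : Filter.Tendsto (fun n => ∑ f ∈ F, (1 -
        ((((Φ n : Set G) + {f}) ∩ (Φ n : Set G)).ncard : ℝ) / ((Φ n).card : ℝ)))
        Filter.atTop (nhds 0) := by
      have := tendsto_finsetSum F fun f _ => (hΦ f).const_sub 1
      simpa using this
    filter_upwards [hlim.eventually_lt_const (by norm_num : (0 : ℝ) < 1 / 2),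
      -- At `g = 0` the Følner quotient is `0 / 0 = 0` for empty `Φ n`, so this excludes empty sets.
      (hΦ 0).eventually_ne one_ne_zero] with n hn hn0
    have hpos : (0 : ℝ) < (Φ n).card := by
      refine lt_of_le_of_ne (Nat.cast_nonneg _) fun h0 => hn0 ?_
      rw [← h0, div_zero]
    have key := card_le_of_forall_exists_notMem h (Φ n)
    have key' : 1 ≤ ∑ f ∈ F, ((1 - ((X ∩ (Φ n : Set G)).ncard : ℝ) / (Φ n).card) +
        (1 - ((((Φ n : Set G) + {f}) ∩ (Φ n : Set G)).ncard : ℝ) / ((Φ n).card : ℝ))) := by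
      refine le_of_mul_le_mul_right ?_ hpos
      rw [one_mul, Finset.sum_mul]
      refine key.trans_eq (Finset.sum_congr rfl fun f _ => ?_)
      field_simp
    rw [Finset.sum_add_distrib, Finset.sum_const, nsmul_eq_mul] at key'
    have h2 : (1 : ℝ) / (2 * F.card) * F.card = 1 / 2 := by field_simp
    have h3 : (1 : ℝ) / (2 * F.card) ≤ 1 - ((X ∩ (Φ n : Set G)).ncard : ℝ) / (Φ n).card := by
      refine le_of_mul_le_mul_right ?_ (by positivity : (0 : ℝ) < F.card)
      rw [h2]
      linarith
    linarith
  · have : (1 : ℝ) / (2 * F.card) ≤ 1 := by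
      rw [div_le_one (by positivity)]
      linarith
    linarith

end ThickComplement

theorem theorem1p4 :
    (∀ ε : ℝ, 0 < ε → ∃ S A : Set G₂,
      1 - ε < upperBanachDensity A ∧
      (∀ g : G₂, IsSetOfTopologicalRecurrence (S + {g})) ∧
      ¬ IsPiecewiseSyndetic (S + A)) ∧
    (¬ ∀ S A : Set G₂,
      0 < BohrCompactification.haar G₂ (closure (BohrCompactification.of G₂ '' S)) →
      0 < upperBanachDensity A → IsPiecewiseSyndetic (S + A)) ∧
    (¬ ∀ S A : Set G₂,
      0 < BohrCompactification.haar G₂ (closure (BohrCompactification.of G₂ '' S)) →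
      0 < upperBanachDensity A → IsPiecewiseBohr (S + A)) ∧
    (¬ ∀ S A : Set G₂,
      IsBohrDense S →
      0 < upperBanachDensity A → upperBanachDensity (S + A) = 1) := by
  refine ⟨fun ε hε => ?_, ?_⟩
  · obtain ⟨S, A, C, F, hS, hA, hdisj, hmono, hfin, hF, hC⟩ := exists_recurrent_dense_disjoint hε
    exact ⟨S, A, hA, fun g => (hS g).isSetOfTopologicalRecurrence,
      not_isPiecewiseSyndetic_of_disjoint hdisj hmono hfin hF hC⟩
  -- One pair with `ε = 1`, for which `1 - ε = 0`, refutes all three implications.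
  obtain ⟨S, A, C, F, hS, hA, hdisj, hmono, hfin, hF, hC⟩ := exists_recurrent_dense_disjoint one_pos
  rw [sub_self] at hA
  have hdense := isBohrDense_of_isChromaticallyRecurrent hS
  have hnot := not_isPiecewiseSyndetic_of_disjoint hdisj hmono hfin hF hC
  refine ⟨fun h => hnot (h S A hdense.haar_closure_pos hA),
    fun h => hnot (h S A hdense.haar_closure_pos hA).isPiecewiseSyndetic,
    fun h => (upperBanachDensity_lt_one (F := (hfin 1).toFinset) fun x => ?_).ne (h S A hdense hA)⟩
  obtain ⟨f, hf, h0⟩ := hC 0 x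
  refine ⟨f, (hfin 1).mem_toFinset.2 hf, fun hX => Set.disjoint_left.1 hdisj hX ?_⟩
  simpa using h0 0 (zero_mem _)
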